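/- Let $\widehat{\mathbb Z}=\prod_p\mathbb Z_p$ and let $$\Omega_B=\{(r,a)\mid a\in\widehat{\mathbb Z}/\widehat{\mathbb Z}^*,\ r\in\widehat{\mathbb Z}/a\widehat{\mathbb Z}\},$$ a compact space with the quotient topology from $\widehat{\mathbb Z}\times\widehat{\mathbb Z}$. The semigroup $\mathbb Z\rtimes\mathbb N^\times$ acts on it by $(m,k)(r,a)=(m+kr,ka)$. Put $\omega_1=(0,\widehat{\mathbb Z}^*)$ and $\omega_m=(0,m)\omega_1$. Let $C(\Omega_B)\rtimes\mathbb Z$ be the crossed product C$^*$-algebra for the action of $\mathbb Z\times\{1\}$, with canonical unitary $u$, so that $ufu^*=f((1,1)^{-1}\,\cdot)$. For $n\in\mathbb N^\times$ let $\alpha_n$ be the $*$-endomorphism of $C(\Omega_B)\rtimes\mathbb Z$ with $\alpha_n(fu^k)=f((0,n)^{-1}\,\cdot)\,u^{nk}$, where $f((0,n)^{-1}\,\cdot)$ is extended by zero off $(0,n)\Omega_B$. For $m\in\mathbb N^\times$ let $E_{\omega_m}\colon C(\Omega_B)\rtimes\mathbb Z\to C^*(\mathbb Z)\cong C(\mathbb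 T)$ be the contractive linear map with $$E_{\omega_m}(fu^k)(z)=\Bigl(\frac1m\sum_{l=0}^{m-1}f((l,m)\omega_1)\Bigr)z^k .$$ For $\beta\in\mathbb R$ let $T_\beta$ be the set of tracial states $\tau$ on $C(\Omega_B)\rtimes\mathbb Z$ such that $\tau\circ\alpha_n=n^{-\beta}\tau$ for all $n\in\mathbb N^\times$ and such that $\tau$ is of the form $$\tau=\sum_{m=1}^\infty\lambda_{m*}\circ E_{\omega_m},\qquad(\ast)$$ where each $\lambda_m$ is a positive measure on $\mathbb T$ invariant under the rotation by $2\pi/m$, $\lambda_{m*}$ is integration against $\lambda_m$, and $\sum_m\lambda_m(\mathbb T)=1$. **Proposition.** If $\beta>2$, then for every $\tau\in T_\beta$ the sequence $(\lambda_m)_m$ in $(\ast)$ is unique, and the map $\tau\mapsto\zeta(\beta-1)\lambda_1$ is an affine bijection from the convex set $T_\beta$ onto the set of (Borel) probability measures on the circle $\mathbb T$. If $\beta\le2$, then $T_\beta=\emptyset$. -/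

import Mathlib

noncomputable section

namespace AddBoundary

/-! ### The additive boundary `Ω_B` and the action of `ℤ ⋊ ℕ^×` -/

instance factPrime (p : Nat.Primes) : Fact (p : ℕ).Prime := ⟨p.2⟩

/-- The ring `Ẑ = ∏_p ℤ_p` of profinite integers, with the product topology. -/
abbrev ZHat : Type := ∀ p : Nat.Primes, ℤ_[(p : ℕ)]

/-- `(r, a) ∼ (r', a')` iff `a` and `a'` have the same class in `Ẑ / Ẑ^*` and `r` and `r'` have
the same class in `Ẑ / aẐ`. -/
def boundarySetoid : Setoid (ZHat × ZHat) where
  r x y := Associated x.2 y.2 ∧ x.2 ∣ x.1 - y.1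
  iseqv :=
    { refl := fun x => ⟨Associated.refl _, by simp⟩
      symm := fun {x y} h => ⟨h.1.symm, by
        have := h.1.symm.dvd.trans h.2
        rwa [dvd_sub_comm] at this⟩
      trans := fun {x y z} h h' => ⟨h.1.trans h'.1, by
        have h1 := dvd_add h.2 (h.1.dvd.trans h'.2)
        simpa using h1⟩ }

/-- The additive boundary `Ω_B = {(r, a) : a ∈ Ẑ / Ẑ^*, r ∈ Ẑ / aẐ}`, with the quotient topology
from `Ẑ × Ẑ`. -/
def OmegaB : Type := Quotient boundarySetoid

instance : TopologicalSpace OmegaB := inferInstanceAs (TopologicalSpace (Quotient boundarySetoid))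
instance : CompactSpace OmegaB := inferInstanceAs (CompactSpace (Quotient boundarySetoid))

/-- The class of `(r, a)` in `Ω_B`. -/
def mk (x : ZHat × ZHat) : OmegaB := Quotient.mk boundarySetoid x

lemma mk_eq_iff {x y : ZHat × ZHat} :
    mk x = mk y ↔ Associated x.2 y.2 ∧ x.2 ∣ x.1 - y.1 :=
  Quotient.eq (r := boundarySetoid)

lemma mk_surjective : Function.Surjective mk := Quotient.mk_surjective

lemma isQuotientMap_mk : Topology.IsQuotientMap mk := isQuotientMap_quot_mk

lemma continuous_mk : Continuous mk := isQuotientMap_mk.continuous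

/-- `(r, a) ↦ (m + k r, k a)` on `Ẑ × Ẑ`. -/
def preAct (m : ℤ) (k : ℕ+) (x : ZHat × ZHat) : ZHat × ZHat :=
  ((m : ZHat) + ((k : ℕ) : ZHat) * x.1, ((k : ℕ) : ZHat) * x.2)

lemma continuous_preAct (m : ℤ) (k : ℕ+) : Continuous (preAct m k) := by
  unfold preAct; fun_prop

lemma preAct_rel (m : ℤ) (k : ℕ+) (x y : ZHat × ZHat) (h : mk x = mk y) :
    mk (preAct m k x) = mk (preAct m k y) := by
  rw [mk_eq_iff] at h ⊢
  refine ⟨h.1.mul_left _, ?_⟩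
  have : (preAct m k x).1 - (preAct m k y).1 = ((k : ℕ) : ZHat) * (x.1 - y.1) := by
    simp only [preAct]; ring
  rw [this]
  exact mul_dvd_mul_left _ h.2

/-- The action of `(m, k) ∈ ℤ ⋊ ℕ^×` on `Ω_B`: `(m, k)(r, a) = (m + k r, k a)`. -/
def act (m : ℤ) (k : ℕ+) : OmegaB → OmegaB :=
  Quotient.lift (fun x => mk (preAct m k x))
    (fun x y h => preAct_rel m k x y (Quotient.sound (s := boundarySetoid) h))

@[simp] lemma act_mk (m : ℤ) (k : ℕ+) (x : ZHat × ZHat) : act m k (mk x) = mk (preAct m k x) := rfl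

lemma continuous_act (m : ℤ) (k : ℕ+) : Continuous (act m k) :=
  isQuotientMap_mk.continuous_iff.2 (continuous_mk.comp (continuous_preAct m k))

/-- The point `ω₁ = (0, Ẑ^*)`. -/
def omegaOne : OmegaB := mk (0, 1)

/-- `(l, m)(l', m') = (l + m l', m m')` -/
lemma act_act (l l' : ℤ) (m m' : ℕ+) (x : OmegaB) :
    act l m (act l' m' x) = act (l + m * l') (m * m') x := by
  obtain ⟨x, rfl⟩ := mk_surjective x
  simp only [act_mk, preAct]
  congr 2
  · push_cast; ring
  · push_cast; ring

lemma act_zero_one (x : OmegaB) : act 0 1 x = x := by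
  obtain ⟨x, rfl⟩ := mk_surjective x
  simp [preAct]

/-! ### The extension by zero of `f ((0, n)⁻¹ ·)` -/

lemma zhat_cast_mul_injective (n : ℕ+) {x y : ZHat}
    (h : ((n : ℕ) : ZHat) * x = ((n : ℕ) : ZHat) * y) : x = y := by
  funext p
  have := congrFun h p
  simp only [Pi.mul_apply, Pi.natCast_apply] at this
  exact mul_left_cancel₀ (by simp) this

lemma act_zero_injective (n : ℕ+) : Function.Injective (act 0 n) := by
  intro x y h
  obtain ⟨x, rfl⟩ := mk_surjective x
  obtain ⟨y, rfl⟩ := mk_surjective y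
  simp only [act_mk, mk_eq_iff, preAct, Int.cast_zero, zero_add] at h ⊢
  obtain ⟨⟨u, hu⟩, c, hc⟩ := h
  refine ⟨⟨u, zhat_cast_mul_injective n (by rw [← mul_assoc, hu])⟩, c,
    zhat_cast_mul_injective n (by rw [mul_sub, hc, mul_assoc])⟩

lemma isOpen_dvd_padicInt (p : Nat.Primes) (n : ℕ+) :
    IsOpen {y : ℤ_[(p : ℕ)] | ((n : ℕ) : ℤ_[(p : ℕ)]) ∣ y} := by
  have hn : ((n : ℕ) : ℤ_[(p : ℕ)]) ≠ 0 := by simp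
  have h1 := PadicInt.unitCoeff_spec hn
  have : {y : ℤ_[(p : ℕ)] | ((n : ℕ) : ℤ_[(p : ℕ)]) ∣ y} = Metric.closedBall 0
      (((p : ℕ) : ℝ) ^ (-(((n : ℕ) : ℤ_[(p : ℕ)]).valuation : ℤ))) := by
    ext y
    rw [Set.mem_ofPred_eq, mem_closedBall_zero_iff, PadicInt.norm_le_pow_iff_mem_span_pow,
      Ideal.mem_span_singleton]
    conv_lhs => rw [h1]
    exact IsUnit.mul_left_dvd (Units.isUnit _)
  rw [this]
  refine IsUltrametricDist.isOpen_closedBall _ ?_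
  have := p.2.pos
  positivity

lemma isOpen_dvd_zhat (n : ℕ+) : IsOpen {x : ZHat | ((n : ℕ) : ZHat) ∣ x} := by
  have key : {x : ZHat | ((n : ℕ) : ZHat) ∣ x} =
      Set.pi {p : Nat.Primes | (p : ℕ) ∣ n}
        (fun p => {y : ℤ_[(p : ℕ)] | ((n : ℕ) : ℤ_[(p : ℕ)]) ∣ y}) := by
    ext x
    simp only [Set.mem_ofPred_eq, Set.mem_pi, pi_dvd_iff, Pi.natCast_apply]
    refine ⟨fun h p _ => h p, fun h p => ?_⟩
    by_cases hp : (p : ℕ) ∣ n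
    · exact h p hp
    · apply IsUnit.dvd
      rw [PadicInt.isUnit_iff]
      refine le_antisymm (PadicInt.norm_le_one _) (not_lt.1 fun hlt => hp ?_)
      have h2 := (PadicInt.norm_int_lt_one_iff_dvd (p := (p : ℕ)) ((n : ℕ) : ℤ)).1
        (by simpa using hlt)
      exact_mod_cast h2
  rw [key]
  refine isOpen_set_pi ?_ (fun p _ => isOpen_dvd_padicInt p n)
  refine Set.Finite.of_finite_image (f := fun p : Nat.Primes => (p : ℕ)) ?_
    (fun a _ b _ h => Subtype.ext h)
  refine (Set.finite_Iic (n : ℕ)).subset ?_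
  rintro _ ⟨p, hp, rfl⟩
  exact Nat.le_of_dvd n.pos hp

lemma preAct_zero_isOpenEmbedding (n : ℕ+) : Topology.IsOpenEmbedding (preAct 0 n) := by
  have hcl : Topology.IsClosedEmbedding (preAct 0 n) := by
    refine (continuous_preAct 0 n).isClosedEmbedding ?_
    intro x y h
    simp only [preAct, Int.cast_zero, zero_add, Prod.mk.injEq] at h
    exact Prod.ext (zhat_cast_mul_injective n h.1) (zhat_cast_mul_injective n h.2)
  refine ⟨hcl.isEmbedding, ?_⟩
  have : Set.range (preAct 0 n) =
      {x : ZHat | ((n : ℕ) : ZHat) ∣ x} ×ˢ {x : ZHat | ((n : ℕ) : ZHat) ∣ x} := by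
    ext ⟨r, a⟩
    simp only [Set.mem_range, preAct, Int.cast_zero, zero_add, Set.mem_prod, Set.mem_ofPred_eq,
      Prod.mk.injEq, Prod.exists]
    constructor
    · rintro ⟨r', a', rfl, rfl⟩
      exact ⟨dvd_mul_right _ _, dvd_mul_right _ _⟩
    · rintro ⟨⟨r', rfl⟩, a', rfl⟩
      exact ⟨r', a', rfl, rfl⟩
  rw [this]
  exact (isOpen_dvd_zhat n).prod (isOpen_dvd_zhat n)

lemma mk_mem_range_act_iff (n : ℕ+) (x : ZHat × ZHat) :
    mk x ∈ Set.range (act 0 n) ↔ x ∈ Set.range (preAct 0 n) := by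
  constructor
  · rintro ⟨y, hy⟩
    obtain ⟨y, rfl⟩ := mk_surjective y
    rw [act_mk, mk_eq_iff] at hy
    simp only [preAct, Int.cast_zero, zero_add] at hy
    obtain ⟨a, ha⟩ := (dvd_mul_right _ _).trans hy.1.dvd
    obtain ⟨r, hr⟩ := (dvd_sub_right (dvd_mul_right _ _)).1 ((dvd_mul_right _ _).trans hy.2)
    exact ⟨(r, a), by simp [preAct, ← ha, ← hr]⟩
  · rintro ⟨y, rfl⟩
    exact ⟨mk y, rfl⟩

lemma continuous_extend_act (n : ℕ+) (f : C(OmegaB, ℂ)) :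
    Continuous (Function.extend (act 0 n) f 0) := by
  rw [isQuotientMap_mk.continuous_iff, continuous_iff_continuousAt]
  have hemb := preAct_zero_isOpenEmbedding n
  intro x
  by_cases hx : x ∈ Set.range (preAct 0 n)
  · obtain ⟨y, rfl⟩ := hx
    rw [← hemb.continuousAt_iff]
    have : (Function.extend (act 0 n) f 0 ∘ mk) ∘ preAct 0 n = f ∘ mk := by
      funext z
      exact (act_zero_injective n).extend_apply f 0 (mk z)
    rw [this]
    exact (f.continuous.comp continuous_mk).continuousAt
  · have hcl : IsClosed (Set.range (preAct 0 n)) :=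
      (isCompact_range (continuous_preAct 0 n)).isClosed
    have : (Function.extend (act 0 n) f 0 ∘ mk) =ᶠ[nhds x] fun _ => (0 : ℂ) := by
      filter_upwards [hcl.isOpen_compl.mem_nhds hx] with z hz
      exact Function.extend_apply' _ _ _
        (fun h => hz ((mk_mem_range_act_iff n z).1 h))
    exact continuousAt_const.congr this.symm

/-- `f ↦ f ((0, n)⁻¹ ·)`, where the right-hand side is zero off the clopen set `(0, n) Ω_B`. -/
def alphaFun (n : ℕ+) (f : C(OmegaB, ℂ)) : C(OmegaB, ℂ) :=
  ⟨Function.extend (act 0 n) f 0, continuous_extend_act n f⟩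

lemma alphaFun_act (n : ℕ+) (f : C(OmegaB, ℂ)) (x : OmegaB) :
    alphaFun n f (act 0 n x) = f x :=
  (act_zero_injective n).extend_apply f 0 x

lemma alphaFun_of_notMem (n : ℕ+) (f : C(OmegaB, ℂ)) {x : OmegaB}
    (hx : x ∉ Set.range (act 0 n)) : alphaFun n f x = 0 :=
  Function.extend_apply' _ _ _ hx


/-! ### The algebraic crossed product -/

/-- `(k • f)(x) = f((k, 1)⁻¹ x)` for `k ∈ ℤ` and `f ∈ C(Ω_B)`. -/
instance translationAction : MulSemiringAction (Multiplicative ℤ) C(OmegaB, ℂ) where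
  smul k f := f.comp ⟨act (-k.toAdd) 1, continuous_act _ _⟩
  one_smul f := by ext x; exact congrArg f (act_zero_one x)
  mul_smul k l f := by
    ext x
    refine congrArg f ?_
    change act (-(k.toAdd + l.toAdd)) 1 x = act (-l.toAdd) 1 (act (-k.toAdd) 1 x)
    rw [act_act]
    congr 1
    · simp
  smul_zero k := by ext x; rfl
  smul_add k f g := by ext x; rfl
  smul_one k := by ext x; rfl
  smul_mul k f g := by ext x; rfl

lemma translate_apply (k : Multiplicative ℤ) (f : C(OmegaB, ℂ)) (x : OmegaB) :
    (k • f) x = f (act (-k.toAdd) 1 x) := rfl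

lemma translate_star (k : Multiplicative ℤ) (f : C(OmegaB, ℂ)) : k • star f = star (k • f) := rfl

lemma translate_smul (k : Multiplicative ℤ) (c : ℂ) (f : C(OmegaB, ℂ)) :
    k • (c • f) = c • (k • f) := rfl

/-- The `*`-algebra of finite sums `∑ f_k u^k`, with `f_k ∈ C(Ω_B)` and `u f u^* = f((1,1)⁻¹ ·)`. -/
def CrossedAlg : Type := SkewMonoidAlgebra C(OmegaB, ℂ) (Multiplicative ℤ)

namespace CrossedAlg

instance : Ring CrossedAlg :=
  inferInstanceAs (Ring (SkewMonoidAlgebra C(OmegaB, ℂ) (Multiplicative ℤ)))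
instance : Module ℂ CrossedAlg :=
  inferInstanceAs (Module ℂ (SkewMonoidAlgebra C(OmegaB, ℂ) (Multiplicative ℤ)))

/-- The element `f u^k`. -/
def mon (f : C(OmegaB, ℂ)) (k : ℤ) : CrossedAlg :=
  SkewMonoidAlgebra.single (Multiplicative.ofAdd k) f

lemma mon_add (f g : C(OmegaB, ℂ)) (k : ℤ) : mon (f + g) k = mon f k + mon g k :=
  SkewMonoidAlgebra.single_add _ _ _

lemma smul_mon (c : ℂ) (f : C(OmegaB, ℂ)) (k : ℤ) : c • mon f k = mon (c • f) k :=
  SkewMonoidAlgebra.smul_single _ _ _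

lemma one_eq : (1 : CrossedAlg) = mon 1 0 := rfl

/-- `(f u^k) (g u^l) = f g((k, 1)⁻¹ ·) u^(k + l)` -/
lemma mon_mul_mon (f g : C(OmegaB, ℂ)) (k l : ℤ) :
    mon f k * mon g l = mon (f * (Multiplicative.ofAdd k • g)) (k + l) :=
  SkewMonoidAlgebra.single_mul_single

lemma induction {P : CrossedAlg → Prop} (a : CrossedAlg) (hmon : ∀ f k, P (mon f k))
    (hadd : ∀ a b, P a → P b → P (a + b)) : P a :=
  SkewMonoidAlgebra.induction_on a
    (by have := hmon 0 0; rwa [mon, SkewMonoidAlgebra.single_zero] at this)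
    (fun g f => hmon f g.toAdd) (fun {a b} => hadd a b)

/-- Additive maps out of the algebraic crossed product. -/
def liftAdd {M : Type*} [AddCommMonoid M] (φ : ℤ → C(OmegaB, ℂ) →+ M) : CrossedAlg →+ M :=
  (Finsupp.liftAddHom (fun g : Multiplicative ℤ => φ g.toAdd)).comp
    (SkewMonoidAlgebra.coeffAddEquiv (k := C(OmegaB, ℂ)) (G := Multiplicative ℤ)).toAddMonoidHom

@[simp] lemma liftAdd_mon {M : Type*} [AddCommMonoid M] (φ : ℤ → C(OmegaB, ℂ) →+ M)
    (f : C(OmegaB, ℂ)) (k : ℤ) : liftAdd φ (mon f k) = φ k f :=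
  Finsupp.liftAddHom_apply_single _ _ _

/-- Linear maps out of the algebraic crossed product. -/
def lift {M : Type*} [AddCommMonoid M] [Module ℂ M] (φ : ℤ → C(OmegaB, ℂ) →ₗ[ℂ] M) :
    CrossedAlg →ₗ[ℂ] M :=
  { liftAdd (fun k => (φ k).toAddMonoidHom) with
    map_smul' := fun c a => by
      induction a using induction with
      | hmon f k => simp [smul_mon]
      | hadd a b ha hb => simp_all [smul_add] }

@[simp] lemma lift_mon {M : Type*} [AddCommMonoid M] [Module ℂ M]
    (φ : ℤ → C(OmegaB, ℂ) →ₗ[ℂ] M) (f : C(OmegaB, ℂ)) (k : ℤ) : lift φ (mon f k) = φ k f :=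
  liftAdd_mon (fun k => (φ k).toAddMonoidHom) f k

instance : Algebra ℂ CrossedAlg := Algebra.ofModule
  (fun c a b => by
    induction a using induction with
    | hadd a a' ha ha' => simp only [smul_add, add_mul, ha, ha']
    | hmon f k =>
      induction b using induction with
      | hadd b b' hb hb' => simp only [smul_add, mul_add, hb, hb']
      | hmon g l => simp only [smul_mon, mon_mul_mon, smul_mul_assoc])
  (fun c a b => by
    induction a using induction with
    | hadd a a' ha ha' => simp only [smul_add, add_mul, ha, ha']
    | hmon f k =>
      induction b using induction with
      | hadd b b' hb hb' => simp only [smul_add, mul_add, hb, hb']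
      | hmon g l => simp only [smul_mon, mon_mul_mon, translate_smul, mul_smul_comm])

/-- `(f u^k)^* = u^(-k) f^*`. -/
def starHom : CrossedAlg →+ CrossedAlg :=
  liftAdd fun k =>
    { toFun := fun f => mon (Multiplicative.ofAdd (-k) • star f) (-k)
      map_zero' := by
        rw [star_zero, smul_zero]; exact SkewMonoidAlgebra.single_zero _
      map_add' := fun f g => by rw [star_add, smul_add, mon_add] }

lemma starHom_mon (f : C(OmegaB, ℂ)) (k : ℤ) :
    starHom (mon f k) = mon (Multiplicative.ofAdd (-k) • star f) (-k) :=
  liftAdd_mon _ f k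

instance : StarRing CrossedAlg where
  star := starHom
  star_involutive a := by
    induction a using induction with
    | hadd a b ha hb => rw [map_add, map_add, ha, hb]
    | hmon f k =>
      rw [starHom_mon, starHom_mon, neg_neg, ← translate_star, star_star, smul_smul, ← ofAdd_add]
      simp
  star_add := map_add starHom
  star_mul a b := by
    change starHom _ = starHom _ * starHom _
    induction a using induction with
    | hadd a a' ha ha' => simp only [add_mul, mul_add, map_add, ha, ha']
    | hmon f k =>
      induction b using induction with
      | hadd b b' hb hb' => simp only [add_mul, mul_add, map_add, hb, hb']
      | hmon g l =>
        simp only [mon_mul_mon, starHom_mon, star_mul, smul_mul', smul_smul, ← translate_star,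
          ← ofAdd_add]
        simp [add_comm]

lemma star_mon (f : C(OmegaB, ℂ)) (k : ℤ) :
    star (mon f k) = mon (Multiplicative.ofAdd (-k) • star f) (-k) := starHom_mon f k

instance : StarModule ℂ CrossedAlg where
  star_smul c a := by
    induction a using induction with
    | hadd a b ha hb => simp only [smul_add, star_add, ha, hb]
    | hmon f k => simp only [smul_mon, star_mon, star_smul, translate_smul]

end CrossedAlg

/-! ### The maximal C*-norm and the crossed product `C(Ω_B) ⋊ ℤ` -/

/-- C*-seminorms on a complex `*`-algebra. -/
structure IsCStarSeminorm {A : Type*} [Ring A] [StarRing A] [Algebra ℂ A]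
    (p : Seminorm ℂ A) : Prop where
  mul_le : ∀ a b, p (a * b) ≤ p a * p b
  star_mul_self : ∀ a, p (star a * a) = p a ^ 2

section CStarSeminorm

variable {A : Type*} [Ring A] [StarRing A] [Algebra ℂ A] {p : Seminorm ℂ A}

lemma IsCStarSeminorm.star_eq (hp : IsCStarSeminorm p) (a : A) : p (star a) = p a := by
  have key : ∀ b : A, p b ≤ p (star b) := fun b => by
    have h := hp.mul_le (star b) b
    rw [hp.star_mul_self] at h
    rcases (apply_nonneg p b).eq_or_lt with h0 | h0
    · rw [← h0]; exact apply_nonneg p _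
    · nlinarith
  exact le_antisymm (by simpa using key (star a)) (key a)

lemma IsCStarSeminorm.one_le (hp : IsCStarSeminorm p) : p (1 : A) ≤ 1 := by
  have h := hp.star_mul_self 1
  rw [star_one, one_mul] at h
  nlinarith [apply_nonneg p (1 : A)]

/-- A C*-seminorm is at most one on unitaries. -/
lemma IsCStarSeminorm.unitary_le (hp : IsCStarSeminorm p) {u : A} (hu : star u * u = 1) :
    p u ≤ 1 := by
  have h := hp.star_mul_self u
  rw [hu] at h
  have h1 := hp.one_le
  nlinarith [apply_nonneg p u]

end CStarSeminorm

namespace CrossedAlg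

variable {p : Seminorm ℂ CrossedAlg}

lemma seminorm_real_le (hp : IsCStarSeminorm p) (h : C(OmegaB, ℂ)) (hs : star h = h)
    (h1 : ‖h‖ ≤ 1) : p (mon h 0) ≤ 1 := by
  have hre : ∀ x, ((h x).re : ℂ) = h x := fun x => by
    have := congrArg (fun g : C(OmegaB, ℂ) => g x) hs
    exact Complex.conj_eq_iff_re.1 this
  have hle : ∀ x, (h x).re ^ 2 ≤ 1 := fun x => by
    have h2 : |(h x).re| ≤ 1 := (Complex.abs_re_le_norm _).trans ((h.norm_coe_le_norm x).trans h1)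
    rw [← sq_abs]
    nlinarith [abs_nonneg (h x).re]
  let v : C(OmegaB, ℂ) :=
    ⟨fun x => ((h x).re : ℂ) + (Real.sqrt (1 - (h x).re ^ 2) : ℝ) * Complex.I, by fun_prop⟩
  have hv : star v * v = 1 := by
    ext x
    change (starRingEnd ℂ) (v x) * v x = 1
    rw [mul_comm, Complex.mul_conj, Complex.normSq_apply]
    have hx := Real.mul_self_sqrt (sub_nonneg.2 (hle x))
    norm_cast
    simp only [v, ContinuousMap.coe_mk, Complex.add_re, Complex.ofReal_re, Complex.mul_re,
      Complex.I_re, mul_zero, Complex.ofReal_im, Complex.I_im, mul_one, sub_self, add_zero,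
      Complex.add_im, Complex.mul_im, zero_add]
    nlinarith
  have hsum : h = (2⁻¹ : ℂ) • (v + star v) := by
    ext x
    change h x = (2⁻¹ : ℂ) * (v x + (starRingEnd ℂ) (v x))
    rw [Complex.add_conj]
    rw [← hre x]
    simp [v]
  have hu : star (mon v 0) * mon v 0 = 1 := by
    rw [star_mon, mon_mul_mon, one_eq]
    simp [hv]
  have hp1 := hp.unitary_le hu
  have hp2 : p (mon (star v) 0) ≤ 1 := by
    have := hp.star_eq (mon v 0)
    rw [star_mon] at this
    simp only [neg_zero, ofAdd_zero, one_smul] at this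
    rw [this]; exact hp1
  rw [hsum, ← smul_mon, mon_add, map_smul_eq_mul]
  have := map_add_le_add p (mon v 0) (mon (star v) 0)
  norm_num
  linarith

lemma seminorm_self_le (hp : IsCStarSeminorm p) (h : C(OmegaB, ℂ)) (hs : star h = h) :
    p (mon h 0) ≤ ‖h‖ := by
  rcases (norm_nonneg h).eq_or_lt with h0 | h0
  · rw [norm_eq_zero.1 h0.symm]
    have : (mon 0 0 : CrossedAlg) = 0 := SkewMonoidAlgebra.single_zero _
    simp [this]
  · have hc : (‖h‖ : ℂ) ≠ 0 := by exact_mod_cast h0.ne'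
    have h1 := seminorm_real_le hp ((‖h‖ : ℂ)⁻¹ • h) (by rw [star_smul, hs]; simp)
      (by rw [norm_smul, norm_inv, Complex.norm_real, norm_norm, inv_mul_cancel₀ h0.ne'])
    rw [← smul_mon, map_smul_eq_mul, norm_inv, Complex.norm_real, norm_norm] at h1
    rwa [inv_mul_le_iff₀ h0, mul_one] at h1

/-- Every C*-seminorm satisfies `p (f u^k) ≤ ‖f‖`. -/
lemma seminorm_mon_le (hp : IsCStarSeminorm p) (f : C(OmegaB, ℂ)) (k : ℤ) :
    p (mon f k) ≤ ‖f‖ := by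
  have h1 := hp.star_mul_self (star (mon f k))
  rw [star_star, hp.star_eq, star_mon, mon_mul_mon, smul_smul, ← ofAdd_add] at h1
  simp only [add_neg_cancel, ofAdd_zero, one_smul] at h1
  have h2 := seminorm_self_le hp (f * star f) (by simp [mul_comm])
  rw [h1, CStarRing.norm_self_mul_star] at h2
  nlinarith [norm_nonneg f, apply_nonneg p (mon f k)]

lemma bddAbove_seminorms (a : CrossedAlg) :
    BddAbove (Set.range fun p : {p : Seminorm ℂ CrossedAlg // IsCStarSeminorm p} => p.1 a) := by
  induction a using induction with
  | hmon f k =>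
    refine ⟨‖f‖, ?_⟩
    rintro _ ⟨p, rfl⟩
    exact seminorm_mon_le p.2 f k
  | hadd a b ha hb =>
    obtain ⟨c, hc⟩ := ha
    obtain ⟨d, hd⟩ := hb
    refine ⟨c + d, ?_⟩
    rintro _ ⟨p, rfl⟩
    exact (map_add_le_add p.1 a b).trans (add_le_add (hc ⟨p, rfl⟩) (hd ⟨p, rfl⟩))

lemma isCStarSeminorm_zero : IsCStarSeminorm (0 : Seminorm ℂ CrossedAlg) :=
  ⟨fun _ _ => by simp, fun _ => by simp⟩

instance : Nonempty {p : Seminorm ℂ CrossedAlg // IsCStarSeminorm p} :=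
  ⟨⟨0, isCStarSeminorm_zero⟩⟩

/-- The maximal C*-seminorm: the pointwise supremum of all C*-seminorms. -/
def maxNorm (a : CrossedAlg) : ℝ :=
  ⨆ p : {p : Seminorm ℂ CrossedAlg // IsCStarSeminorm p}, p.1 a

lemma le_maxNorm (hp : IsCStarSeminorm p) (a : CrossedAlg) : p a ≤ maxNorm a :=
  le_ciSup (bddAbove_seminorms a) ⟨p, hp⟩

lemma maxNorm_nonneg (a : CrossedAlg) : 0 ≤ maxNorm a :=
  (apply_nonneg (0 : Seminorm ℂ CrossedAlg) a).trans (le_maxNorm isCStarSeminorm_zero a)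

lemma maxNorm_le {a : CrossedAlg} {c : ℝ}
    (h : ∀ p : Seminorm ℂ CrossedAlg, IsCStarSeminorm p → p a ≤ c) : maxNorm a ≤ c :=
  ciSup_le fun p => h p.1 p.2

lemma maxNorm_mul_le (a b : CrossedAlg) : maxNorm (a * b) ≤ maxNorm a * maxNorm b :=
  maxNorm_le fun p hp => (hp.mul_le a b).trans
    (mul_le_mul (le_maxNorm hp a) (le_maxNorm hp b) (apply_nonneg p b) (maxNorm_nonneg a))

instance : SeminormedRing CrossedAlg where
  norm := maxNorm
  dist a b := maxNorm (-a + b)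
  dist_self a := by
    rw [neg_add_cancel]
    exact le_antisymm (maxNorm_le fun p _ => (map_zero p).le) (maxNorm_nonneg _)
  dist_comm a b := by
    have key : ∀ c : CrossedAlg, maxNorm c ≤ maxNorm (-c) := fun c =>
      maxNorm_le fun p hp => (map_neg_eq_map p c) ▸ le_maxNorm hp (-c)
    have h1 : -(-a + b) = -b + a := by abel
    have h2 : -(-b + a) = -a + b := by abel
    exact le_antisymm (h1 ▸ key (-a + b)) (h2 ▸ key (-b + a))
  dist_triangle a b c := maxNorm_le fun p hp => by
    have h : -a + c = (-a + b) + (-b + c) := by abel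
    rw [h]
    exact (map_add_le_add p _ _).trans (add_le_add (le_maxNorm hp _) (le_maxNorm hp _))
  dist_eq _ _ := rfl
  norm_mul_le := maxNorm_mul_le

lemma norm_def (a : CrossedAlg) : ‖a‖ = maxNorm a := rfl

lemma norm_mon_le (f : C(OmegaB, ℂ)) (k : ℤ) : ‖mon f k‖ ≤ ‖f‖ :=
  maxNorm_le fun _ hp => seminorm_mon_le hp f k

instance : NormedAlgebra ℂ CrossedAlg where
  norm_smul_le c a := maxNorm_le fun p hp => by
    rw [map_smul_eq_mul]
    exact mul_le_mul_of_nonneg_left (le_maxNorm hp a) (norm_nonneg c)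

lemma norm_star_le (a : CrossedAlg) : ‖star a‖ ≤ ‖a‖ :=
  maxNorm_le fun _ hp => (hp.star_eq a).le.trans (le_maxNorm hp a)

lemma norm_sq_le (a : CrossedAlg) : ‖a‖ * ‖a‖ ≤ ‖star a * a‖ := by
  have h : ‖a‖ ≤ Real.sqrt ‖star a * a‖ := maxNorm_le fun p hp => by
    refine Real.le_sqrt_of_sq_le ?_
    rw [← hp.star_mul_self]
    exact le_maxNorm hp _
  calc ‖a‖ * ‖a‖ ≤ Real.sqrt ‖star a * a‖ * Real.sqrt ‖star a * a‖ :=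
        mul_le_mul h h (norm_nonneg a) (Real.sqrt_nonneg _)
    _ = ‖star a * a‖ := Real.mul_self_sqrt (norm_nonneg _)

lemma isometry_star : Isometry (star : CrossedAlg → CrossedAlg) := by
  refine AddMonoidHomClass.isometry_of_norm starHom fun a => le_antisymm (norm_star_le a) ?_
  have := norm_star_le (star a)
  rwa [star_star] at this

end CrossedAlg

open UniformSpace in
/-- The crossed product C*-algebra `C(Ω_B) ⋊ ℤ`: the completion of the algebraic crossed product
in the maximal C*-norm. -/
def CrossedProduct : Type := Completion CrossedAlg

namespace CrossedProduct

open UniformSpace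

instance : NormedRing CrossedProduct := inferInstanceAs (NormedRing (Completion CrossedAlg))
instance : CompleteSpace CrossedProduct := inferInstanceAs (CompleteSpace (Completion CrossedAlg))
instance : Algebra ℂ CrossedProduct := inferInstanceAs (Algebra ℂ (Completion CrossedAlg))
instance : NormedAlgebra ℂ CrossedProduct where
  norm_smul_le c a := norm_smul_le (α := ℂ) (β := Completion CrossedAlg) c a

/-- The canonical map from the algebraic crossed product. -/
def incl : CrossedAlg →L[ℂ] CrossedProduct := Completion.toComplL (𝕜 := ℂ) (E := CrossedAlg)

lemma incl_apply (a : CrossedAlg) : incl a = (a : Completion CrossedAlg) := rfl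

lemma norm_incl (a : CrossedAlg) : ‖incl a‖ = ‖a‖ := Completion.norm_coe a

lemma incl_mul (a b : CrossedAlg) : incl (a * b) = incl a * incl b := Completion.coe_mul a b

lemma incl_one : incl 1 = 1 := rfl

lemma denseRange_incl : DenseRange incl := Completion.denseRange_coe

lemma isUniformInducing_incl : IsUniformInducing incl := Completion.isUniformInducing_coe CrossedAlg

lemma induction {P : CrossedProduct → Prop} (a : CrossedProduct) (hc : IsClosed {a | P a})
    (h : ∀ a, P (incl a)) : P a := Completion.induction_on (α := CrossedAlg) a hc h

instance : Star CrossedProduct := ⟨Completion.map (star : CrossedAlg → CrossedAlg)⟩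

lemma continuous_star' : Continuous (star : CrossedProduct → CrossedProduct) :=
  Completion.continuous_map

lemma star_incl (a : CrossedAlg) : star (incl a) = incl (star a) :=
  Completion.map_coe CrossedAlg.isometry_star.uniformContinuous a

instance : StarRing CrossedProduct where
  star_involutive a := by
    induction a using induction with
    | hc => exact isClosed_eq (continuous_star'.comp continuous_star') continuous_id
    | h a => rw [star_incl, star_incl, star_star]
  star_add a b := by
    induction a using induction with
    | hc =>
      exact isClosed_eq (continuous_star'.comp (continuous_id.add continuous_const))
        (continuous_star'.add continuous_const)
    | h a =>
      induction b using induction with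
      | hc =>
        exact isClosed_eq (continuous_star'.comp (continuous_const.add continuous_id))
          (continuous_const.add continuous_star')
      | h b => rw [← map_add, star_incl, star_incl, star_incl, star_add, map_add]
  star_mul a b := by
    induction a using induction with
    | hc =>
      exact isClosed_eq (continuous_star'.comp (continuous_id.mul continuous_const))
        (continuous_const.mul continuous_star')
    | h a =>
      induction b using induction with
      | hc =>
        exact isClosed_eq (continuous_star'.comp (continuous_const.mul continuous_id))
          (continuous_star'.mul continuous_const)
      | h b => rw [← incl_mul, star_incl, star_incl, star_incl, star_mul, incl_mul]

instance : StarModule ℂ CrossedProduct where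
  star_smul c a := by
    induction a using induction with
    | hc =>
      exact isClosed_eq (continuous_star'.comp (continuous_const_smul c))
        (continuous_star'.const_smul (star c))
    | h a => rw [← map_smul, star_incl, star_incl, star_smul, map_smul]

instance : CStarRing CrossedProduct where
  norm_mul_self_le a := by
    induction a using induction with
    | hc =>
      exact isClosed_le (continuous_norm.mul continuous_norm)
        (continuous_norm.comp (continuous_star'.mul continuous_id))
    | h a =>
      rw [star_incl, ← incl_mul, norm_incl, norm_incl]
      exact CrossedAlg.norm_sq_le a

instance : CStarAlgebra CrossedProduct where

/-- The element `f u^k` of `C(Ω_B) ⋊ ℤ`. -/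
def mon (f : C(OmegaB, ℂ)) (k : ℤ) : CrossedProduct := incl (CrossedAlg.mon f k)

end CrossedProduct

/-! ### The endomorphisms `α_n` -/

lemma alphaFun_mul (n : ℕ+) (f g : C(OmegaB, ℂ)) :
    alphaFun n (f * g) = alphaFun n f * alphaFun n g := by
  ext x
  by_cases hx : x ∈ Set.range (act 0 n)
  · obtain ⟨y, rfl⟩ := hx
    simp [alphaFun_act]
  · simp [alphaFun_of_notMem, hx]

lemma alphaFun_star (n : ℕ+) (f : C(OmegaB, ℂ)) : alphaFun n (star f) = star (alphaFun n f) := by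
  ext x
  by_cases hx : x ∈ Set.range (act 0 n)
  · obtain ⟨y, rfl⟩ := hx
    simp [alphaFun_act]
  · simp [alphaFun_of_notMem, hx]

lemma alphaFun_translate (n : ℕ+) (k : ℤ) (f : C(OmegaB, ℂ)) :
    alphaFun n (Multiplicative.ofAdd k • f) =
      Multiplicative.ofAdd ((n : ℤ) * k) • alphaFun n f := by
  have hcomm : ∀ (j : ℤ) (y : OmegaB), act ((n : ℤ) * j) 1 (act 0 n y) = act 0 n (act j 1 y) := by
    intro j y
    rw [act_act, act_act]
    simp
  ext x
  rw [translate_apply, toAdd_ofAdd, ← mul_neg]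
  by_cases hx : x ∈ Set.range (act 0 n)
  · obtain ⟨y, rfl⟩ := hx
    rw [alphaFun_act, hcomm, alphaFun_act]
    rfl
  · rw [alphaFun_of_notMem _ _ hx, alphaFun_of_notMem]
    rintro ⟨y, hy⟩
    refine hx ⟨act k 1 y, ?_⟩
    rw [← hcomm, hy, act_act]
    simp [act_zero_one]

/-- `alphaFun` as a linear map. -/
def alphaLin (n : ℕ+) : C(OmegaB, ℂ) →ₗ[ℂ] C(OmegaB, ℂ) where
  toFun := alphaFun n
  map_add' f g := by
    ext x
    by_cases hx : x ∈ Set.range (act 0 n)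
    · obtain ⟨y, rfl⟩ := hx
      simp [alphaFun_act]
    · simp [alphaFun_of_notMem, hx]
  map_smul' c f := by
    ext x
    by_cases hx : x ∈ Set.range (act 0 n)
    · obtain ⟨y, rfl⟩ := hx
      simp [alphaFun_act]
    · simp [alphaFun_of_notMem, hx]

namespace CrossedAlg

/-- `f ↦ f u^k` as a linear map. -/
def monLin (k : ℤ) : C(OmegaB, ℂ) →ₗ[ℂ] CrossedAlg where
  toFun f := mon f k
  map_add' f g := mon_add f g k
  map_smul' c f := (smul_mon c f k).symm

/-- `f u^k ↦ α_n(f) u^(n k)` on the algebraic crossed product. -/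
def alpha (n : ℕ+) : CrossedAlg →ₗ[ℂ] CrossedAlg :=
  lift fun k => (monLin ((n : ℤ) * k)).comp (alphaLin n)

lemma alpha_mon (n : ℕ+) (f : C(OmegaB, ℂ)) (k : ℤ) :
    alpha n (mon f k) = mon (alphaFun n f) ((n : ℤ) * k) := lift_mon _ f k

lemma alpha_mul (n : ℕ+) (a b : CrossedAlg) : alpha n (a * b) = alpha n a * alpha n b := by
  induction a using induction with
  | hadd a a' ha ha' => simp only [add_mul, map_add, ha, ha']
  | hmon f k =>
    induction b using induction with
    | hadd b b' hb hb' => simp only [mul_add, map_add, hb, hb']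
    | hmon g l =>
      simp only [mon_mul_mon, alpha_mon, alphaFun_mul, alphaFun_translate, mul_add]

lemma alpha_star (n : ℕ+) (a : CrossedAlg) : alpha n (star a) = star (alpha n a) := by
  induction a using induction with
  | hadd a a' ha ha' => simp only [star_add, map_add, ha, ha']
  | hmon f k =>
    simp only [star_mon, alpha_mon, alphaFun_translate, alphaFun_star, mul_neg]

lemma norm_alpha_le (n : ℕ+) (a : CrossedAlg) : ‖alpha n a‖ ≤ ‖a‖ :=
  maxNorm_le fun p hp => by
    have h : IsCStarSeminorm (p.comp (alpha n)) :=
      ⟨fun a b => by simpa [alpha_mul] using hp.mul_le _ _,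
        fun a => by simpa [alpha_mul, alpha_star] using hp.star_mul_self _⟩
    exact le_maxNorm h a

end CrossedAlg

namespace CrossedProduct

/-- The endomorphism `α_n` of `C(Ω_B) ⋊ ℤ`, determined by `α_n(f u^k) = f((0,n)⁻¹ ·) u^(n k)`. -/
def alpha (n : ℕ+) : CrossedProduct →L[ℂ] CrossedProduct :=
  (incl.comp ((CrossedAlg.alpha n).mkContinuous 1
    fun a => by simpa using CrossedAlg.norm_alpha_le n a)).extend incl

lemma alpha_incl (n : ℕ+) (a : CrossedAlg) : alpha n (incl a) = incl (CrossedAlg.alpha n a) :=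
  ContinuousLinearMap.extend_eq _ denseRange_incl isUniformInducing_incl a

lemma alpha_mon (n : ℕ+) (f : C(OmegaB, ℂ)) (k : ℤ) :
    alpha n (mon f k) = mon (alphaFun n f) ((n : ℤ) * k) := by
  rw [mon, alpha_incl, CrossedAlg.alpha_mon]; rfl

end CrossedProduct

/-! ### The conditional expectations `E_{ω_m} : C(Ω_B) ⋊ ℤ → C*(ℤ) ≅ C(𝕋)` -/

/-- `z ↦ z^k`, the image of `u^k` under `C*(ℤ) ≅ C(𝕋)`. -/
def zpowFun (k : ℤ) : C(Circle, ℂ) := ⟨fun z => ((z ^ k : Circle) : ℂ), by fun_prop (disch := simp)⟩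

/-- The average `m⁻¹ ∑_{l < m} f((l, m) ω₁)` of `f` over the orbit of `ω_m = (0, m) ω₁`. -/
def orbitAverage (m : ℕ+) : C(OmegaB, ℂ) →ₗ[ℂ] ℂ where
  toFun f := ((m : ℕ) : ℂ)⁻¹ * ∑ l ∈ Finset.range m, f (act l m omegaOne)
  map_add' f g := by simp [Finset.sum_add_distrib, mul_add]
  map_smul' c f := by
    simp only [ContinuousMap.coe_smul, Pi.smul_apply, smul_eq_mul, RingHom.id_apply,
      ← Finset.mul_sum]
    ring

namespace CrossedAlg

/-- `f u^k ↦ (m⁻¹ ∑_{l < m} f((l, m) ω₁)) z^k` on the algebraic crossed product. -/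
def expect (m : ℕ+) : CrossedAlg →ₗ[ℂ] C(Circle, ℂ) :=
  lift fun k => (orbitAverage m).smulRight (zpowFun k)

lemma expect_mon (m : ℕ+) (f : C(OmegaB, ℂ)) (k : ℤ) :
    expect m (mon f k) = orbitAverage m f • zpowFun k := lift_mon _ f k

section Matrix

open scoped Matrix.Norms.L2Operator

/-- The `i`-th point of the orbit of `ω_m`. -/
def orbitPoint (m : ℕ+) (i : ZMod m) : OmegaB := act i.val m omegaOne

lemma act_orbitPoint (m : ℕ+) (k : ℤ) (i : ZMod m) :
    act k 1 (orbitPoint m i) = orbitPoint m (i + k) := by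
  unfold orbitPoint
  rw [act_act, omegaOne, act_mk, act_mk, mk_eq_iff]
  refine ⟨by simp [preAct], ?_⟩
  have h : ((m : ℕ) : ℤ) ∣ (k + i.val) - ((i + (k : ZMod m)).val : ℤ) := by
    rw [← ZMod.intCast_zmod_eq_zero_iff_dvd]
    push_cast
    simp
    ring
  have h2 := (Int.castRingHom ZHat).map_dvd h
  simpa [preAct] using h2

/-- The matrix of `f u^k` in the covariant representation on `ℓ²(ℤ/m)` with `u` acting as `z`
times the cyclic shift. -/
def orbitMat (m : ℕ+) (z : Circle) (k : ℤ) : C(OmegaB, ℂ) →ₗ[ℂ] Matrix (ZMod m) (ZMod m) ℂ where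
  toFun f := Matrix.of fun i j =>
    if i = j + (k : ZMod m) then f (orbitPoint m i) * ((z ^ k : Circle) : ℂ) else 0
  map_add' f g := by
    ext i j
    by_cases h : i = j + (k : ZMod m) <;> simp [h, add_mul]
  map_smul' c f := by
    ext i j
    by_cases h : i = j + (k : ZMod m) <;> simp [h, mul_assoc]

/-- The representation of the algebraic crossed product on `ℓ²(ℤ/m)`. -/
def orbitRep (m : ℕ+) (z : Circle) : CrossedAlg →ₗ[ℂ] Matrix (ZMod m) (ZMod m) ℂ :=
  lift (orbitMat m z)

lemma orbitRep_mon (m : ℕ+) (z : Circle) (f : C(OmegaB, ℂ)) (k : ℤ) (i j : ZMod m) :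
    orbitRep m z (mon f k) i j =
      if i = j + (k : ZMod m) then f (orbitPoint m i) * ((z ^ k : Circle) : ℂ) else 0 := by
  rw [orbitRep, lift_mon]; rfl

lemma orbitRep_mul (m : ℕ+) (z : Circle) (a b : CrossedAlg) :
    orbitRep m z (a * b) = orbitRep m z a * orbitRep m z b := by
  induction a using induction with
  | hadd a a' ha ha' => simp only [add_mul, map_add, ha, ha']
  | hmon f k =>
    induction b using induction with
    | hadd b b' hb hb' => simp only [mul_add, map_add, hb, hb']
    | hmon g l =>
      ext i j
      rw [mon_mul_mon, orbitRep_mon, Matrix.mul_apply, Finset.sum_eq_single (i - (k : ZMod m))]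
      · have h1 : (i = j + ((k + l : ℤ) : ZMod m)) ↔ (i - (k : ZMod m) = j + (l : ZMod m)) := by
          push_cast
          rw [sub_eq_iff_eq_add, add_assoc, add_comm (l : ZMod m)]
        simp only [orbitRep_mon, sub_add_cancel, if_true, h1]
        split_ifs
        · rw [ContinuousMap.mul_apply, translate_apply, toAdd_ofAdd, act_orbitPoint, zpow_add,
            Circle.coe_mul]
          push_cast
          rw [← sub_eq_add_neg]
          ring
        · simp
      · intro q _ hq
        rw [orbitRep_mon, if_neg, zero_mul]
        rintro rfl
        simp at hq
      · simp

lemma orbitRep_star (m : ℕ+) (z : Circle) (a : CrossedAlg) :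
    orbitRep m z (star a) = star (orbitRep m z a) := by
  induction a using induction with
  | hadd a a' ha ha' => simp only [star_add, map_add, ha, ha']
  | hmon f k =>
    ext i j
    rw [Matrix.star_apply, star_mon, orbitRep_mon, orbitRep_mon]
    have h1 : (i = j + ((-k : ℤ) : ZMod m)) ↔ (j = i + (k : ZMod m)) := by
      push_cast
      rw [← sub_eq_add_neg, eq_sub_iff_add_eq, eq_comm]
    simp only [h1]
    split_ifs with h
    · rw [translate_apply, toAdd_ofAdd, neg_neg, act_orbitPoint, ← h, zpow_neg, Circle.coe_inv_eq_conj]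
      simp
    · simp

lemma norm_orbitRep_le (m : ℕ+) (z : Circle) (a : CrossedAlg) : ‖orbitRep m z a‖ ≤ ‖a‖ := by
  have h : IsCStarSeminorm ((normSeminorm ℂ (Matrix (ZMod m) (ZMod m) ℂ)).comp (orbitRep m z)) :=
    ⟨fun a b => by simpa [orbitRep_mul] using norm_mul_le _ _,
      fun a => by
        simp only [Seminorm.comp_apply, coe_normSeminorm, orbitRep_mul, orbitRep_star]
        rw [CStarRing.norm_star_mul_self, sq]⟩
  exact le_maxNorm h a

lemma sum_zmod (m : ℕ+) (F : ℕ → ℂ) :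
    ∑ i : ZMod m, F i.val = ∑ l ∈ Finset.range m, F l := by
  obtain ⟨m, hm⟩ := m
  obtain ⟨m, rfl⟩ := Nat.exists_eq_succ_of_ne_zero hm.ne'
  exact Fin.sum_univ_eq_sum_range F (m + 1)

lemma expect_apply_eq (m : ℕ+) (z : Circle) (a : CrossedAlg) :
    expect m a z = ((m : ℕ) : ℂ)⁻¹ * ∑ i, ∑ j, orbitRep m z a i j := by
  induction a using induction with
  | hadd a b ha hb =>
    simp only [map_add, ContinuousMap.add_apply, ha, hb, Matrix.add_apply, Finset.sum_add_distrib,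
      mul_add]
  | hmon f k =>
    simp only [expect_mon, orbitRep_mon]
    have h : ∀ i : ZMod m, (∑ j : ZMod m, if i = j + (k : ZMod m) then
        f (orbitPoint m i) * ((z ^ k : Circle) : ℂ) else 0) =
        f (act i.val m omegaOne) * ((z ^ k : Circle) : ℂ) := by
      intro i
      rw [Finset.sum_eq_single (i - (k : ZMod m))]
      · simp [orbitPoint]
      · intro q _ hq
        rw [if_neg]
        rintro rfl
        simp at hq
      · simp
    simp only [h]
    rw [sum_zmod m (fun l => f (act l m omegaOne) * ((z ^ k : Circle) : ℂ)), ← Finset.sum_mul,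
      ← mul_assoc]
    rfl

lemma norm_sum_matrix_le (m : ℕ+) (M : Matrix (ZMod m) (ZMod m) ℂ) :
    ‖∑ i, ∑ j, M i j‖ ≤ (m : ℕ) * ‖M‖ := by
  let x : EuclideanSpace ℂ (ZMod m) := WithLp.toLp 2 (fun _ => (1 : ℂ))
  have hx : ‖x‖ * ‖x‖ = (m : ℕ) := by
    rw [← sq, EuclideanSpace.norm_sq_eq]
    simp [x, ZMod.card]
  have h1 := Matrix.l2_opNorm_mulVec M x
  have h2 := norm_inner_le_norm (𝕜 := ℂ) x ((EuclideanSpace.equiv (ZMod m) ℂ).symm (M.mulVec x.ofLp))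
  have h3 : inner ℂ x ((EuclideanSpace.equiv (ZMod m) ℂ).symm (M.mulVec x.ofLp)) =
      ∑ i, ∑ j, M i j := by
    simp [PiLp.inner_apply, x, Matrix.mulVec, dotProduct]
  rw [h3] at h2
  calc ‖∑ i, ∑ j, M i j‖ ≤ ‖x‖ * (‖M‖ * ‖x‖) := h2.trans (by gcongr)
    _ = (m : ℕ) * ‖M‖ := by rw [← hx]; ring

lemma norm_expect_le (m : ℕ+) (a : CrossedAlg) : ‖expect m a‖ ≤ ‖a‖ := by
  rw [ContinuousMap.norm_le _ (norm_nonneg a)]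
  intro z
  have hm : (0 : ℝ) < (m : ℕ) := by exact_mod_cast m.pos
  rw [expect_apply_eq, norm_mul, norm_inv, Complex.norm_natCast, inv_mul_le_iff₀ hm]
  exact (norm_sum_matrix_le m _).trans (by gcongr; exact norm_orbitRep_le m z a)

end Matrix

end CrossedAlg

namespace CrossedProduct

/-- The conditional expectation `E_{ω_m} : C(Ω_B) ⋊ ℤ → C*(ℤ) ≅ C(𝕋)`, determined by
`E_{ω_m}(f u^k) = (m⁻¹ ∑_{l < m} f((l, m) ω₁)) z^k`. -/
def expect (m : ℕ+) : CrossedProduct →L[ℂ] C(Circle, ℂ) :=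
  ((CrossedAlg.expect m).mkContinuous 1
    fun a => by simpa using CrossedAlg.norm_expect_le m a).extend incl

lemma expect_incl (m : ℕ+) (a : CrossedAlg) : expect m (incl a) = CrossedAlg.expect m a :=
  ContinuousLinearMap.extend_eq _ denseRange_incl isUniformInducing_incl a

lemma expect_mon (m : ℕ+) (f : C(OmegaB, ℂ)) (k : ℤ) :
    expect m (mon f k) = orbitAverage m f • zpowFun k := by
  rw [mon, expect_incl, CrossedAlg.expect_mon]

end CrossedProduct

/-! ### Traces -/

instance : MeasurableSpace Circle := borel Circle
instance : BorelSpace Circle := ⟨rfl⟩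

open MeasureTheory

/-- Tracial states of `C(Ω_B) ⋊ ℤ`. -/
structure IsTracialState (τ : CrossedProduct →L[ℂ] ℂ) : Prop where
  map_one : τ 1 = 1
  nonneg : ∀ a, 0 ≤ (τ (star a * a)).re ∧ (τ (star a * a)).im = 0
  tracial : ∀ a b, τ (a * b) = τ (b * a)

/-- The scaling condition `τ ∘ α_n = n^(-β) τ` for all `n ∈ ℕ^×`. -/
def IsScaling (β : ℝ) (τ : CrossedProduct →L[ℂ] ℂ) : Prop :=
  ∀ (n : ℕ+) (a : CrossedProduct),
    τ (CrossedProduct.alpha n a) = ((((n : ℕ) : ℝ) ^ (-β) : ℝ) : ℂ) * τ a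

/-- `m`-rotation invariance: invariance under the rotation by `2π/m`. -/
def IsRotationInvariant (m : ℕ+) (μ : Measure Circle) : Prop :=
  μ.map (fun z => Circle.exp (2 * Real.pi / (m : ℕ)) * z) = μ

/-- `τ = ∑_m λ_{m*} ∘ E_{ω_m}`, where `λ_m` is an `m`-rotation invariant positive finite measure on
the circle and `∑_m λ_m(𝕋) = 1`. -/
structure IsPeriodicDecomposition (τ : CrossedProduct →L[ℂ] ℂ) (lam : ℕ+ → Measure Circle) :
    Prop where
  invariant : ∀ m, IsRotationInvariant m (lam m)
  total : ∑' m, lam m Set.univ = 1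
  hasSum : ∀ a, HasSum (fun m => ∫ z, CrossedProduct.expect m a z ∂(lam m)) (τ a)

/-- The tracial states of the form `∑_m λ_{m*} ∘ E_{ω_m}` that satisfy the scaling condition. -/
def scalingTraces (β : ℝ) : Set (CrossedProduct →L[ℂ] ℂ) :=
  {τ | IsTracialState τ ∧ IsScaling β τ ∧ ∃ lam, IsPeriodicDecomposition τ lam}
end AddBoundary

end

noncomputable section

namespace AddBoundary

open MeasureTheory

/-! ### Moments of measures on the circle -/

/-! Everything is reduced to the moments `∫ z^k dλ_m`. They determine a finite measure on the
circle, because trigonometric polynomials are dense (`measure_ext_of_moment`), and invariance under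
rotation by `2π/m` says exactly that they vanish off `mℤ` (`isRotationInvariant_iff`). On `f u^k` a
trace of the given form takes the value `∑_m A_m(f) c_m`, where `A_m` is the average over the orbit
of `ω_m` and `c_m` is the `k`-th moment of `λ_m`.

The averages `A_m` are independent with respect to summable coefficients
(`eq_zero_of_tsum_orbitAverage`). Indeed, the indicator of `(0, n)Ω_B` has average `1/n` when `n ∣
m` and `0` otherwise, so vanishing of `∑_m A_m(f) c_m` for all `f` kills every sum of `c` over the
multiples of `n`. A sieve over finite sets of primes then isolates each `c_n`. This yields
uniqueness of the decomposition.

The same independence turns scaling into an identity between moments (`isScaling_iff`): the `nk`-th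
moment of `λ_{nm}` is `n^(1-β)` times the `k`-th moment of `λ_m`. Equivalently, the image of
`λ_{nm}` under `z ↦ z^n` is `n^(1-β) λ_m`. Taking `m = 1` and using invariance, `λ_1` determines all
`λ_n`, and `λ_n` has mass `n^(1-β) λ_1(𝕋)`. Total mass one therefore forces `∑ n^(1-β)` to converge,
i.e. `β > 2`, and gives `ζ(β-1) λ_1(𝕋) = 1`.

Conversely, a probability measure `μ` is lifted along `z ↦ z^n` with equal mass on the `n` roots
(`rootLift`). Weighting the lifts by `n^(1-β)/ζ(β-1)` gives measures with the required moments. The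
series of functionals converges in norm, and `exists_tracialState` shows that its sum is a tracial
state. -/

lemma integrable_circle (μ : Measure Circle) [IsFiniteMeasure μ] (f : C(Circle, ℂ)) :
    Integrable f μ :=
  f.continuous.integrable_of_hasCompactSupport (HasCompactSupport.of_compactSpace f)

/-- Integration against a finite measure as a continuous functional on `C(𝕋)`. -/
def integralCLM (μ : Measure Circle) [IsFiniteMeasure μ] : C(Circle, ℂ) →L[ℂ] ℂ :=
  LinearMap.mkContinuous
    { toFun := fun f => ∫ z, f z ∂μ
      map_add' := fun f g => integral_add (integrable_circle μ f) (integrable_circle μ g)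
      map_smul' := fun c f => integral_const_mul c f }
    (μ.real Set.univ)
    (fun f => by
      rw [mul_comm]
      exact norm_integral_le_of_norm_le_const (ae_of_all _ f.norm_coe_le_norm))

lemma integralCLM_apply (μ : Measure Circle) [IsFiniteMeasure μ] (f : C(Circle, ℂ)) :
    integralCLM μ f = ∫ z, f z ∂μ := rfl

lemma norm_integralCLM_le (μ : Measure Circle) [IsFiniteMeasure μ] :
    ‖integralCLM μ‖ ≤ μ.real Set.univ :=
  LinearMap.mkContinuous_norm_le _ measureReal_nonneg _

/-- The moment `∫ z^k dμ`. -/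
def moment (μ : Measure Circle) (k : ℤ) : ℂ := ∫ z, zpowFun k z ∂μ

lemma zpowFun_apply (k : ℤ) (z : Circle) : zpowFun k z = ((z ^ k : Circle) : ℂ) := rfl

lemma norm_zpowFun_apply (k : ℤ) (z : Circle) : ‖zpowFun k z‖ = 1 := Circle.norm_coe _

lemma moment_zero (μ : Measure Circle) : moment μ 0 = (μ.real Set.univ : ℂ) := by
  simp [moment, zpowFun_apply]

lemma norm_moment_le (μ : Measure Circle) [IsFiniteMeasure μ] (k : ℤ) :
    ‖moment μ k‖ ≤ μ.real Set.univ := by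
  simpa [moment] using norm_integral_le_of_norm_le_const (μ := μ) (f := zpowFun k) (C := 1)
    (ae_of_all _ fun z => (norm_zpowFun_apply k z).le)

lemma moment_map {μ : Measure Circle} {g : Circle → Circle} (hg : Measurable g) (k : ℤ) :
    moment (μ.map g) k = ∫ z, zpowFun k (g z) ∂μ :=
  integral_map hg.aemeasurable (zpowFun k).continuous.aestronglyMeasurable

lemma moment_add (μ ν : Measure Circle) [IsFiniteMeasure μ] [IsFiniteMeasure ν] (k : ℤ) :
    moment (μ + ν) k = moment μ k + moment ν k :=
  integral_add_measure (integrable_circle μ _) (integrable_circle ν _)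

lemma moment_smul (μ : Measure Circle) (c : ENNReal) (k : ℤ) :
    moment (c • μ) k = (c.toReal : ℂ) * moment μ k := by
  rw [moment, integral_smul_measure]; simp [moment]

/-! ### Density of trigonometric polynomials. -/

/-- The star subalgebra of trigonometric polynomials in `C(𝕋)`. -/
def trigPoly : StarSubalgebra ℂ C(Circle, ℂ) where
  toSubalgebra := Algebra.adjoin ℂ (Set.range zpowFun)
  star_mem' := by
    change Algebra.adjoin ℂ (Set.range zpowFun) ≤ star (Algebra.adjoin ℂ (Set.range zpowFun))
    refine Algebra.adjoin_le ?_
    rintro - ⟨n, rfl⟩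
    refine Algebra.subset_adjoin ⟨-n, ContinuousMap.ext fun z => ?_⟩
    rw [zpowFun_apply, zpow_neg, Circle.coe_inv_eq_conj]
    rfl

/-- The characters `z^k` are closed under products, so linear combinations already form the
generated algebra. This lets equality of moments extend by linearity alone. -/
lemma trigPoly_toSubmodule :
    Subalgebra.toSubmodule trigPoly.toSubalgebra = Submodule.span ℂ (Set.range zpowFun) := by
  apply Algebra.adjoin_eq_span_of_subset
  refine Set.Subset.trans ?_ Submodule.subset_span
  intro x hx
  refine Submonoid.closure_induction (fun _ => id) ⟨0, ?_⟩ ?_ hx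
  · ext z; simp [zpowFun_apply]
  · rintro - - - - ⟨m, rfl⟩ ⟨n, rfl⟩
    refine ⟨m + n, ?_⟩
    ext z
    simp [zpowFun_apply, zpow_add₀]

lemma trigPoly_separatesPoints : trigPoly.SeparatesPoints := by
  intro x y hxy
  refine ⟨_, ⟨zpowFun 1, Algebra.subset_adjoin ⟨1, rfl⟩, rfl⟩, ?_⟩
  simpa [zpowFun_apply, Circle.coe_inj] using hxy

/-- A finite measure on the circle is determined by its moments. -/
lemma measure_ext_of_moment {μ ν : Measure Circle} [IsFiniteMeasure μ] [IsFiniteMeasure ν]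
    (h : ∀ k, moment μ k = moment ν k) : μ = ν := by
  have hspan : ∀ f ∈ Submodule.span ℂ (Set.range zpowFun), integralCLM μ f = integralCLM ν f := by
    intro f hf
    induction hf using Submodule.span_induction with
    | mem f hf => obtain ⟨k, rfl⟩ := hf; exact h k
    | zero => simp
    | add f g _ _ hf hg => rw [map_add, map_add, hf, hg]
    | smul c f _ hf => rw [map_smul, map_smul, hf]
  have hall : ∀ f, integralCLM μ f = integralCLM ν f := by
    intro f
    -- Stone–Weierstrass: the trigonometric polynomials are dense, and the two integrals agree on a
    -- closed set.
    have hf : f ∈ trigPoly.topologicalClosure := by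
      rw [ContinuousMap.starSubalgebra_topologicalClosure_eq_top_of_separatesPoints trigPoly
        trigPoly_separatesPoints]
      trivial
    have hcl : IsClosed {f | integralCLM μ f = integralCLM ν f} :=
      isClosed_eq (integralCLM μ).continuous (integralCLM ν).continuous
    refine hcl.closure_subset_iff.2 (fun g hg => ?_) hf
    refine hspan g ?_
    rw [← trigPoly_toSubmodule]
    exact hg
  refine ext_of_forall_integral_eq_of_IsFiniteMeasure fun f => ?_
  have := hall ⟨fun z => (f z : ℂ), by fun_prop⟩
  simp only [integralCLM_apply, ContinuousMap.coe_mk] at this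
  rw [integral_complex_ofReal, integral_complex_ofReal] at this
  exact_mod_cast this

/-! ### Rotation invariance in terms of moments. -/

lemma measurable_rotation (w : Circle) : Measurable fun z : Circle => w * z :=
  (continuous_const.mul continuous_id).measurable

lemma moment_rotate (μ : Measure Circle) (w : Circle) (k : ℤ) :
    moment (μ.map fun z => w * z) k = ((w ^ k : Circle) : ℂ) * moment μ k := by
  rw [moment_map (measurable_rotation w), moment, ← integral_const_mul]
  refine integral_congr_ae (ae_of_all _ fun z => ?_)
  simp [zpowFun_apply, mul_zpow]

lemma exp_two_pi_div_zpow_eq_one_iff (m : ℕ+) (k : ℤ) :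
    Circle.exp (2 * Real.pi / (m : ℕ)) ^ k = 1 ↔ ((m : ℕ) : ℤ) ∣ k := by
  have hm : ((m : ℕ) : ℝ) ≠ 0 := by exact_mod_cast m.ne_zero
  have hpi := Real.pi_ne_zero
  rw [← Circle.exp_intCast_mul, Circle.exp_eq_one]
  refine exists_congr fun n => ?_
  constructor
  · intro h
    field_simp at h
    exact_mod_cast h
  · rintro rfl
    push_cast
    field_simp

/-- A finite measure is invariant under the rotation by `2π/m` if and only if its moments vanish
off `mℤ`. -/
lemma isRotationInvariant_iff (m : ℕ+) (μ : Measure Circle) [IsFiniteMeasure μ] :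
    IsRotationInvariant m μ ↔ ∀ k : ℤ, ¬ ((m : ℕ) : ℤ) ∣ k → moment μ k = 0 := by
  constructor
  · intro h k hk
    have h1 := moment_rotate μ (Circle.exp (2 * Real.pi / (m : ℕ))) k
    rw [show μ.map _ = μ from h] at h1
    -- Invariance gives `c = w^k c` for the moment `c`, with `w = exp(2πi/m)`. If `c ≠ 0`, then `w^k
    -- = 1`, that is `m ∣ k`.
    by_contra h0
    refine hk ((exp_two_pi_div_zpow_eq_one_iff m k).1 (Circle.ext ?_))
    rw [Circle.coe_one]
    exact mul_right_cancel₀ h0 (by rw [one_mul, ← h1])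
  · intro h
    refine measure_ext_of_moment fun k => ?_
    rw [moment_rotate]
    by_cases hk : ((m : ℕ) : ℤ) ∣ k
    · rw [(exp_two_pi_div_zpow_eq_one_iff m k).2 hk, Circle.coe_one, one_mul]
    · rw [h k hk, mul_zero]

/-! ### Lifting measures along `z ↦ z^n`. -/

/-- The `j`-th branch of the `n`-th root on the circle. -/
def rootBranch (n : ℕ+) (j : ℕ) (z : Circle) : Circle :=
  Circle.exp (2 * Real.pi / (n : ℕ)) ^ j * Circle.exp (Complex.arg z / (n : ℕ))

lemma measurable_rootBranch (n : ℕ+) (j : ℕ) : Measurable (rootBranch n j) := by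
  refine (measurable_rotation _).comp (Circle.exp.continuous.measurable.comp ?_)
  exact (Complex.measurable_arg.comp (by fun_prop : Continuous fun z : Circle => (z : ℂ)).measurable).div_const _

/-- The lift of a measure along `z ↦ z^n`, equidistributed over the fibres. -/
def rootLift (n : ℕ+) (μ : Measure Circle) : Measure Circle :=
  ((n : ℕ) : ENNReal)⁻¹ • ∑ j ∈ Finset.range n, μ.map (rootBranch n j)

lemma rootLift_univ (n : ℕ+) (μ : Measure Circle) : rootLift n μ Set.univ = μ Set.univ := by
  have hn : ((n : ℕ) : ENNReal) ≠ 0 := by exact_mod_cast n.ne_zero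
  have h : ∀ j, μ.map (rootBranch n j) Set.univ = μ Set.univ := fun j => by
    rw [Measure.map_apply (measurable_rootBranch n j) MeasurableSet.univ, Set.preimage_univ]
  simp only [rootLift, Measure.smul_apply, Measure.finsetSum_apply, h, Finset.sum_const,
    Finset.card_range, smul_eq_mul, nsmul_eq_mul]
  rw [← mul_assoc, ENNReal.inv_mul_cancel hn (ENNReal.natCast_ne_top _), one_mul]

instance (n : ℕ+) (μ : Measure Circle) [IsFiniteMeasure μ] : IsFiniteMeasure (rootLift n μ) :=
  ⟨by rw [rootLift_univ]; exact measure_lt_top _ _⟩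

lemma moment_rootBranch (n : ℕ+) (j : ℕ) (μ : Measure Circle) (k : ℤ) :
    moment (μ.map (rootBranch n j)) k =
      (((Circle.exp (2 * Real.pi / (n : ℕ)) ^ k : Circle) : ℂ)) ^ j *
        ∫ z : Circle, zpowFun k (Circle.exp (Complex.arg z / (n : ℕ))) ∂μ := by
  rw [moment_map (measurable_rootBranch n j), ← integral_const_mul]
  refine integral_congr_ae (ae_of_all _ fun z => ?_)
  simp only [zpowFun_apply, rootBranch, mul_zpow, Circle.coe_mul]
  rw [← Circle.coe_pow, ← zpow_natCast, ← zpow_natCast, ← zpow_mul, ← zpow_mul, mul_comm k]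

lemma moment_sum {ι : Type*} (s : Finset ι) (μ : ι → Measure Circle) [∀ i, IsFiniteMeasure (μ i)]
    (k : ℤ) : moment (∑ i ∈ s, μ i) k = ∑ i ∈ s, moment (μ i) k :=
  integral_finsetSum_measure fun i _ => integrable_circle (μ i) _

lemma moment_rootLift (n : ℕ+) (μ : Measure Circle) [IsFiniteMeasure μ] (k : ℤ) :
    moment (rootLift n μ) k =
      ((n : ℕ) : ℂ)⁻¹ *
        ((∑ j ∈ Finset.range n, (((Circle.exp (2 * Real.pi / (n : ℕ)) ^ k : Circle) : ℂ)) ^ j) *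
        ∫ z : Circle, zpowFun k (Circle.exp (Complex.arg z / (n : ℕ))) ∂μ) := by
  rw [rootLift, moment_smul, moment_sum, Finset.sum_mul]
  simp [moment_rootBranch]

/-- All branches have `n`-th power `z`, so `z^(nk)` pulls back to `z^k` on each of them and
averaging changes nothing. -/
lemma moment_rootLift_mul (n : ℕ+) (μ : Measure Circle) [IsFiniteMeasure μ] (k : ℤ) :
    moment (rootLift n μ) (((n : ℕ) : ℤ) * k) = moment μ k := by
  have hn : ((n : ℕ) : ℂ) ≠ 0 := by exact_mod_cast n.ne_zero
  have hn' : ((n : ℕ) : ℝ) ≠ 0 := by exact_mod_cast n.ne_zero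
  rw [moment_rootLift, (exp_two_pi_div_zpow_eq_one_iff n _).2 (dvd_mul_right _ _)]
  simp only [Circle.coe_one, one_pow, Finset.sum_const, Finset.card_range, nsmul_eq_mul, mul_one]
  rw [← mul_assoc, inv_mul_cancel₀ hn, one_mul]
  refine integral_congr_ae (ae_of_all _ fun z => ?_)
  simp only [zpowFun_apply]
  rw [zpow_mul, zpow_natCast, ← Circle.exp_natCast_mul, mul_div_cancel₀ _ hn', Circle.exp_arg]

/-- The branches contribute the geometric sum of a nontrivial `n`-th root of unity, which is zero.
Hence the lift is invariant under rotation by `2π/n`. -/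
lemma moment_rootLift_of_not_dvd (n : ℕ+) (μ : Measure Circle) [IsFiniteMeasure μ] {k : ℤ}
    (hk : ¬ ((n : ℕ) : ℤ) ∣ k) : moment (rootLift n μ) k = 0 := by
  have h1 : Circle.exp (2 * Real.pi / (n : ℕ)) ^ k ≠ 1 :=
    fun h => hk ((exp_two_pi_div_zpow_eq_one_iff n k).1 h)
  have h2 : (Circle.exp (2 * Real.pi / (n : ℕ)) ^ k) ^ (n : ℕ) = 1 := by
    rw [← zpow_natCast, ← zpow_mul]
    exact (exp_two_pi_div_zpow_eq_one_iff n _).2 (dvd_mul_left _ _)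
  have h3 : (((Circle.exp (2 * Real.pi / (n : ℕ)) ^ k : Circle) : ℂ)) ≠ 1 :=
    fun h => h1 (Circle.coe_eq_one.1 h)
  rw [moment_rootLift, geom_sum_eq h3, ← Circle.coe_pow, h2]
  simp

/-! ### Orbit averages -/

/-- Divisibility by a prime power `p^j` can be read off in the coordinate `ℤ_p`, where it is a bound
on the `p`-adic norm. -/
lemma natCast_dvd_zhat_iff (n m : ℕ) : (n : ZHat) ∣ (m : ZHat) ↔ n ∣ m := by
  refine ⟨fun h => ?_, fun h => Nat.cast_dvd_cast h⟩
  rw [Nat.dvd_iff_prime_pow_dvd_dvd]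
  intro p j hp hpj
  have h1 : ((p ^ j : ℕ) : ZHat) ∣ (m : ZHat) := (Nat.cast_dvd_cast hpj).trans h
  obtain ⟨c, hc⟩ := h1
  have : Fact p.Prime := ⟨hp⟩
  have h2 : (m : ℤ_[p]) = ((p ^ j : ℕ) : ℤ_[p]) * c ⟨p, hp⟩ := congrFun hc ⟨p, hp⟩
  have h3 : ‖((m : ℤ) : ℤ_[p])‖ ≤ (p : ℝ) ^ (-(j : ℤ)) := by
    rw [PadicInt.norm_le_pow_iff_mem_span_pow, Ideal.mem_span_singleton]
    exact ⟨c ⟨p, hp⟩, by simpa using h2⟩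
  rw [PadicInt.norm_int_le_pow_iff_dvd] at h3
  exact_mod_cast h3

/-- The point is the class of `(l, m)`, and `(0, n)Ω_B` consists of the classes with both
coordinates divisible by `n`. -/
lemma act_omegaOne_mem_range_iff (n m : ℕ+) (l : ℕ) :
    act l m omegaOne ∈ Set.range (act 0 n) ↔ (n : ℕ) ∣ l ∧ (n : ℕ) ∣ m := by
  rw [omegaOne, act_mk, mk_mem_range_act_iff, ← natCast_dvd_zhat_iff, ← natCast_dvd_zhat_iff]
  constructor
  · rintro ⟨⟨r, a⟩, h⟩
    simp only [preAct, Int.cast_zero, zero_add, mul_zero, add_zero, mul_one, Prod.mk.injEq,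
      Int.cast_natCast] at h
    exact ⟨⟨r, h.1.symm⟩, ⟨a, h.2.symm⟩⟩
  · rintro ⟨⟨r, hr⟩, ⟨a, ha⟩⟩
    exact ⟨(r, a), by simp [preAct, hr, ha]⟩

lemma orbitAverage_apply (m : ℕ+) (f : C(OmegaB, ℂ)) :
    orbitAverage m f = ((m : ℕ) : ℂ)⁻¹ * ∑ l ∈ Finset.range m, f (act l m omegaOne) := rfl

lemma orbitAverage_alphaFun_of_not_dvd {n m : ℕ+} (h : ¬ n ∣ m) (f : C(OmegaB, ℂ)) :
    orbitAverage m (alphaFun n f) = 0 := by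
  rw [orbitAverage_apply, Finset.sum_eq_zero, mul_zero]
  intro l _
  refine alphaFun_of_notMem _ _ fun hl => h ?_
  exact PNat.dvd_iff.2 ((act_omegaOne_mem_range_iff n m l).1 hl).2

/-- On the orbit of `ω_{nm}` only the indices `l = nq` with `q < m` survive, and `(nq, nm)ω₁ = (0,
n)(q, m)ω₁`. The two sums coincide, so the factor `1/n` comes from the normalisations `1/(nm)` and
`1/m`. -/
lemma orbitAverage_alphaFun_mul (n m : ℕ+) (f : C(OmegaB, ℂ)) :
    orbitAverage (n * m) (alphaFun n f) = ((n : ℕ) : ℂ)⁻¹ * orbitAverage m f := by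
  have h : ∑ l ∈ Finset.range m, f (act l m omegaOne) =
      ∑ l ∈ Finset.range (n * m : ℕ+), alphaFun n f (act l (n * m) omegaOne) := by
    refine Finset.sum_of_injOn (fun l => (n : ℕ) * l) ?_ ?_ ?_ ?_
    · intro a _ b _ hab
      exact Nat.eq_of_mul_eq_mul_left n.pos hab
    · intro l hl
      simp only [Finset.coe_range, Set.mem_Iio, PNat.mul_coe] at hl ⊢
      exact Nat.mul_lt_mul_of_pos_left hl n.pos
    · intro l hl hl'
      refine alphaFun_of_notMem _ _ fun hr => hl' ?_
      obtain ⟨⟨q, rfl⟩, -⟩ := (act_omegaOne_mem_range_iff n (n * m) l).1 hr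
      simp only [Finset.mem_range, PNat.mul_coe] at hl
      exact ⟨q, by simpa using lt_of_mul_lt_mul_left hl (Nat.zero_le _), rfl⟩
    · intro l _
      rw [← alphaFun_act n f, act_act]
      push_cast
      simp
  rw [orbitAverage_apply, orbitAverage_apply, h, PNat.mul_coe, Nat.cast_mul, mul_inv, mul_assoc]

lemma orbitAverage_one (m : ℕ+) : orbitAverage m 1 = 1 := by
  have hm : ((m : ℕ) : ℂ) ≠ 0 := by exact_mod_cast m.ne_zero
  simp [orbitAverage_apply, hm]

lemma orbitAverage_eq_sum_orbitPoint (m : ℕ+) (f : C(OmegaB, ℂ)) :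
    orbitAverage m f = ((m : ℕ) : ℂ)⁻¹ * ∑ i : ZMod m, f (CrossedAlg.orbitPoint m i) := by
  rw [orbitAverage_apply, ← CrossedAlg.sum_zmod m fun l => f (act l m omegaOne)]
  rfl

/-- Translation acts on the orbit as the shift of `ℤ/m`. Reindexing by `i ↦ i + k` moves the shift
from `g` to `f`, where it becomes a shift by `l ≡ -k`. This is the trace property on monomials whose
total degree lies in `mℤ`. -/
lemma orbitAverage_mul_translate {m : ℕ+} {k l : ℤ} (h : ((m : ℕ) : ℤ) ∣ k + l)
    (f g : C(OmegaB, ℂ)) :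
    orbitAverage m (f * (Multiplicative.ofAdd k • g)) =
      orbitAverage m (g * (Multiplicative.ofAdd l • f)) := by
  rw [orbitAverage_eq_sum_orbitPoint, orbitAverage_eq_sum_orbitPoint]
  congr 1
  rw [← Equiv.sum_comp (Equiv.addRight (k : ZMod m))]
  refine Finset.sum_congr rfl fun i _ => ?_
  have hkl : (k : ZMod m) = -(l : ZMod m) := by
    rw [← ZMod.intCast_zmod_eq_zero_iff_dvd, Int.cast_add] at h
    exact eq_neg_of_add_eq_zero_left h
  simp only [ContinuousMap.mul_apply, translate_apply, toAdd_ofAdd, CrossedAlg.act_orbitPoint,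
    Equiv.coe_addRight, Int.cast_neg]
  rw [add_neg_cancel_right, hkl, mul_comm]

/-! ### Sequences on `ℕ^×` -/

/-- The multiples `m` of `n` such that `m / n` is not divisible by any of the primes in `s`. -/
def coprimeMultiples (s : Finset ℕ) (n : ℕ+) : Set ℕ+ :=
  {m | (n : ℕ) ∣ m ∧ ∀ p ∈ s, p.Prime → ¬ p * (n : ℕ) ∣ m}

/-- One step of inclusion–exclusion. The multiples discarded on account of the new prime `q` form a
set of the same kind, based at `qn` instead of `n`. -/
lemma indicator_coprimeMultiples_insert (c : ℕ+ → ℂ) {s : Finset ℕ} {q : ℕ+} (hq : (q : ℕ).Prime)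
    (hqs : (q : ℕ) ∉ s) (n m : ℕ+) :
    (coprimeMultiples (insert (q : ℕ) s) n).indicator c m =
      (coprimeMultiples s n).indicator c m - (coprimeMultiples s (q * n)).indicator c m := by
  have hdn : (q : ℕ) * n ∣ m → (n : ℕ) ∣ m := (dvd_mul_left _ _).trans
  have hins : m ∈ coprimeMultiples (insert (q : ℕ) s) n ↔
      m ∈ coprimeMultiples s n ∧ ¬ (q : ℕ) * n ∣ m := by
    simp only [coprimeMultiples, Set.mem_ofPred_eq, Finset.forall_mem_insert, hq, true_imp_iff]
    tauto
  have hmul : m ∈ coprimeMultiples s (q * n) ↔ m ∈ coprimeMultiples s n ∧ (q : ℕ) * n ∣ m := by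
    simp only [coprimeMultiples, Set.mem_ofPred_eq, PNat.mul_coe]
    by_cases hd : (q : ℕ) * n ∣ m
    -- With `m = nt` and `q ∣ t`, coprimality of `p` and `q` makes `pq ∣ t` equivalent to `p ∣ t`.
    · have hco : ∀ p ∈ s, p.Prime → (p * ((q : ℕ) * n) ∣ (m : ℕ) ↔ p * n ∣ (m : ℕ)) := by
        intro p hp hpp
        obtain ⟨t, ht⟩ := hdn hd
        have hpq : Nat.Coprime p q := (Nat.coprime_primes hpp hq).2 fun e => hqs (e ▸ hp)
        rw [ht, mul_comm (n : ℕ) t] at hd ⊢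
        rw [← mul_assoc, Nat.mul_dvd_mul_iff_right n.pos, Nat.mul_dvd_mul_iff_right n.pos]
        rw [Nat.mul_dvd_mul_iff_right n.pos] at hd
        exact ⟨fun h => (dvd_mul_right _ _).trans h, fun h => hpq.mul_dvd_of_dvd_of_dvd h hd⟩
      have h := forall₂_congr fun p (hp : p ∈ s) =>
        forall_congr' fun hpp => not_congr (hco p hp hpp)
      rw [h]
      simp [hd, hdn hd]
    · simp [hd]
  classical
  simp only [Set.indicator_apply, hins, hmul]
  by_cases h1 : m ∈ coprimeMultiples s n <;> by_cases h2 : (q : ℕ) * n ∣ m <;> simp [h1, h2]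

/-- If all the sums `∑_{n ∣ m} c_m` vanish, then so do the sums over those multiples `m` of `n` for
which `m / n` is not divisible by any of a given finite set of primes. -/
lemma tsum_coprimeMultiples_eq_zero {c : ℕ+ → ℂ} (hc : Summable c)
    (h : ∀ n : ℕ+, ∑' m, Set.indicator {m | n ∣ m} c m = 0) (s : Finset ℕ) :
    ∀ n : ℕ+, ∑' m, (coprimeMultiples s n).indicator c m = 0 := by
  induction s using Finset.induction_on with
  | empty => intro n; simpa [coprimeMultiples, PNat.dvd_iff] using h n
  | insert q s hqs ih =>
    -- The induction hypothesis must cover all base points, since it is used at both `n` and `qn`.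
    intro n
    by_cases hq : q.Prime
    · obtain ⟨q, rfl⟩ : ∃ q' : ℕ+, (q' : ℕ) = q := ⟨⟨q, hq.pos⟩, rfl⟩
      rw [tsum_congr (indicator_coprimeMultiples_insert c hq hqs n),
        (hc.indicator _).tsum_sub (hc.indicator _), ih, ih, sub_zero]
    · have : coprimeMultiples (insert q s) n = coprimeMultiples s n := by
        simp [coprimeMultiples, hq]
      rw [this, ih]

/-- A proper multiple `m` of `n` is sieved out as soon as `s` contains a prime factor of `m / n`,
while `n` itself always survives. -/
lemma eventually_mem_coprimeMultiples_iff (n m : ℕ+) :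
    ∀ᶠ s : Finset ℕ in Filter.atTop, (m ∈ coprimeMultiples s n ↔ m = n) := by
  by_cases hmn : m = n
  · refine Filter.Eventually.of_forall fun s => iff_of_true ?_ hmn
    subst hmn
    refine ⟨dvd_rfl, fun p _ hp hpm => ?_⟩
    have := Nat.le_of_dvd m.pos hpm
    nlinarith [hp.two_le, m.pos]
  by_cases hnm : (n : ℕ) ∣ m
  · obtain ⟨t, ht⟩ := hnm
    have ht1 : t ≠ 1 := fun ht1 => hmn (PNat.eq (by rw [ht, ht1, mul_one]))
    obtain ⟨p, hp, hpt⟩ := Nat.exists_prime_and_dvd ht1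
    filter_upwards [Filter.eventually_ge_atTop {p}] with s hs
    refine iff_of_false (fun hm => hm.2 p (hs (Finset.mem_singleton_self _)) hp ?_) hmn
    rw [ht, mul_comm]
    exact mul_dvd_mul_left _ hpt
  · exact Filter.Eventually.of_forall fun s => iff_of_false (fun hm => hnm hm.1) hmn

/-- A summable sequence is determined by its sums over the sets of multiples. -/
lemma eq_zero_of_tsum_multiples {c : ℕ+ → ℂ} (hc : Summable c)
    (h : ∀ n : ℕ+, ∑' m, Set.indicator {m | n ∣ m} c m = 0) : c = 0 := by
  classical
  funext n
  have hlim : Filter.Tendsto (fun s : Finset ℕ => ∑' m, (coprimeMultiples s n).indicator c m)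
      Filter.atTop (nhds (∑' m, if m = n then c m else 0)) := by
    -- The sieved sums are all zero and, dominated by `‖c‖`, converge to the single term `c n`.
    refine tendsto_tsum_of_dominated_convergence hc.norm (fun m => ?_)
      (Filter.Eventually.of_forall fun s m => norm_indicator_le_norm_self _ _)
    refine tendsto_const_nhds.congr' ?_
    filter_upwards [eventually_mem_coprimeMultiples_iff n m] with s hs
    simp only [Set.indicator_apply, hs]
  rw [tsum_ite_eq] at hlim
  exact tendsto_nhds_unique hlim (by simp [tsum_coprimeMultiples_eq_zero hc h])

lemma pnat_mul_left_injective (n : ℕ+) : Function.Injective fun m : ℕ+ => n * m :=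
  fun _ _ h => mul_left_cancel h

lemma range_pnat_mul_left (n : ℕ+) : Set.range (fun m : ℕ+ => n * m) = {m | n ∣ m} :=
  Set.ext fun _ => ⟨fun ⟨t, ht⟩ => ⟨t, ht.symm⟩, fun ⟨t, ht⟩ => ⟨t, ht.symm⟩⟩

/-- The functionals `orbitAverage m` are linearly independent in the `ℓ¹` sense. -/
lemma eq_zero_of_tsum_orbitAverage {c : ℕ+ → ℂ} (hc : Summable c)
    (h : ∀ f, ∑' m, orbitAverage m f * c m = 0) : c = 0 := by
  refine eq_zero_of_tsum_multiples hc fun n => ?_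
  have hn : ((n : ℕ) : ℂ)⁻¹ ≠ 0 := inv_ne_zero (by exact_mod_cast n.ne_zero)
  -- The test function is the indicator of `(0, n)Ω_B`.
  have h1 := h (alphaFun n 1)
  have h2 : ∀ m, orbitAverage m (alphaFun n 1) * c m =
      ((n : ℕ) : ℂ)⁻¹ * Set.indicator {m | n ∣ m} c m := by
    intro m
    by_cases hm : n ∣ m
    · rw [Set.indicator_of_mem (by exact hm)]
      obtain ⟨t, rfl⟩ := hm
      rw [orbitAverage_alphaFun_mul, orbitAverage_one, mul_one]
    · rw [Set.indicator_of_notMem (by exact hm), orbitAverage_alphaFun_of_not_dvd hm]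
      simp
  rw [tsum_congr h2, tsum_mul_left] at h1
  exact (mul_eq_zero.1 h1).resolve_left hn

/-! ### Extension from monomials, and positivity of the expectations. -/

open CrossedProduct (mon)

lemma CrossedAlg.hom_ext_mon {M : Type*} [AddCommMonoid M] [Module ℂ M]
    {φ ψ : CrossedAlg →ₗ[ℂ] M} (h : ∀ f k, φ (CrossedAlg.mon f k) = ψ (CrossedAlg.mon f k)) :
    φ = ψ := by
  ext a
  induction a using CrossedAlg.induction with
  | hmon f k => exact h f k
  | hadd a b ha hb => rw [map_add, map_add, ha, hb]

/-- Continuous linear maps on the crossed product are determined by their values on the elements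
`f u^k`. -/
lemma CrossedProduct.ext_mon {M : Type*} [NormedAddCommGroup M] [NormedSpace ℂ M]
    {φ ψ : CrossedProduct →L[ℂ] M} (h : ∀ f k, φ (mon f k) = ψ (mon f k)) : φ = ψ := by
  ext a
  induction a using CrossedProduct.induction with
  | hc => exact isClosed_eq φ.continuous ψ.continuous
  | h a =>
    exact LinearMap.congr_fun (CrossedAlg.hom_ext_mon
      (φ := φ.toLinearMap.comp CrossedProduct.incl.toLinearMap)
      (ψ := ψ.toLinearMap.comp CrossedProduct.incl.toLinearMap) h) a

lemma CrossedProduct.mon_mul_mon (f g : C(OmegaB, ℂ)) (k l : ℤ) :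
    mon f k * mon g l = mon (f * (Multiplicative.ofAdd k • g)) (k + l) := by
  rw [mon, mon, ← CrossedProduct.incl_mul, CrossedAlg.mon_mul_mon]
  rfl

lemma CrossedProduct.mon_one_zero : mon 1 0 = 1 := rfl

lemma CrossedProduct.norm_expect_le (m : ℕ+) : ‖CrossedProduct.expect m‖ ≤ 1 := by
  refine ContinuousLinearMap.opNorm_le_bound _ zero_le_one fun a => ?_
  rw [one_mul]
  induction a using CrossedProduct.induction with
  | hc => exact isClosed_le (CrossedProduct.expect m).continuous.norm continuous_norm
  | h a =>
    rw [CrossedProduct.expect_incl, CrossedProduct.norm_incl]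
    exact CrossedAlg.norm_expect_le m a

open scoped ComplexOrder in
-- The expectation at `z` is `1/m` times the vector functional of `orbitRep m z` at the all-ones
-- vector `ξ`, so its value at `a^* a` is `‖π(a)ξ‖²/m` with `π` this representation.
lemma CrossedAlg.expect_star_mul_self_nonneg (m : ℕ+) (a : CrossedAlg) (z : Circle) :
    0 ≤ CrossedAlg.expect m (star a * a) z := by
  have h : ∑ i, ∑ j, CrossedAlg.orbitRep m z (star a * a) i j =
      ∑ q, star (∑ i, CrossedAlg.orbitRep m z a q i) * ∑ j, CrossedAlg.orbitRep m z a q j := by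
    simp only [CrossedAlg.orbitRep_mul, CrossedAlg.orbitRep_star, Matrix.mul_apply,
      Matrix.star_apply, star_sum, Finset.sum_mul_sum]
    rw [Finset.sum_comm' (t' := Finset.univ) (s' := fun _ => Finset.univ) (by simp)]
    rw [Finset.sum_congr rfl fun j _ => Finset.sum_comm, Finset.sum_comm]
    exact Finset.sum_congr rfl fun q _ => Finset.sum_comm
  rw [CrossedAlg.expect_apply_eq, h]
  refine mul_nonneg ?_ (Finset.sum_nonneg fun q _ => star_mul_self_nonneg _)
  rw [← Complex.ofReal_natCast, ← Complex.ofReal_inv, Complex.zero_le_real]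
  positivity

open scoped ComplexOrder in
lemma CrossedProduct.expect_star_mul_self_nonneg (m : ℕ+) (a : CrossedProduct) (z : Circle) :
    0 ≤ CrossedProduct.expect m (star a * a) z := by
  induction a using CrossedProduct.induction with
  | hc =>
    have hc : Continuous fun a : CrossedProduct => star a * a :=
      CrossedProduct.continuous_star'.mul continuous_id
    exact isClosed_le continuous_const ((continuous_eval_const z).comp
      ((CrossedProduct.expect m).continuous.comp hc))
  | h a =>
    rw [CrossedProduct.star_incl, ← CrossedProduct.incl_mul, CrossedProduct.expect_incl]
    exact CrossedAlg.expect_star_mul_self_nonneg m a z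

lemma integral_expect_mon (μ : Measure Circle) (m : ℕ+) (f : C(OmegaB, ℂ)) (k : ℤ) :
    ∫ z, CrossedProduct.expect m (mon f k) z ∂μ = orbitAverage m f * moment μ k := by
  rw [CrossedProduct.expect_mon, moment, ← integral_const_mul]
  rfl

/-! ### Existence of traces with a given decomposition -/

section Existence

variable {lam : ℕ+ → Measure Circle}

lemma isFiniteMeasure_of_tsum (h : ∑' m, lam m Set.univ = 1) (m : ℕ+) :
    IsFiniteMeasure (lam m) :=
  ⟨((ENNReal.le_tsum m).trans_eq h).trans_lt ENNReal.one_lt_top⟩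

lemma summable_real_univ (h : ∑' m, lam m Set.univ = 1) :
    Summable fun m => (lam m).real Set.univ :=
  ENNReal.summable_toReal (by rw [h]; exact ENNReal.one_ne_top)

lemma tsum_real_univ (h : ∑' m, lam m Set.univ = 1) : ∑' m, (lam m).real Set.univ = 1 := by
  have := isFiniteMeasure_of_tsum h
  have h1 := ENNReal.tsum_toReal_eq (f := fun m => lam m Set.univ) fun m => measure_ne_top _ _
  rw [h, ENNReal.toReal_one] at h1
  exact h1.symm

lemma summable_moment (h : ∑' m, lam m Set.univ = 1) (k : ℤ) :
    Summable fun m => moment (lam m) k := by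
  have := isFiniteMeasure_of_tsum h
  exact (summable_real_univ h).of_norm_bounded fun m => norm_moment_le _ _

/-- The functional `λ_* ∘ E_{ω_m}`. -/
def orbitFunctional (m : ℕ+) (μ : Measure Circle) [IsFiniteMeasure μ] :
    CrossedProduct →L[ℂ] ℂ :=
  (integralCLM μ).comp (CrossedProduct.expect m)

lemma orbitFunctional_apply (m : ℕ+) (μ : Measure Circle) [IsFiniteMeasure μ]
    (a : CrossedProduct) :
    orbitFunctional m μ a = ∫ z, CrossedProduct.expect m a z ∂μ := rfl

lemma norm_orbitFunctional_le (m : ℕ+) (μ : Measure Circle) [IsFiniteMeasure μ] :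
    ‖orbitFunctional m μ‖ ≤ μ.real Set.univ := by
  refine (ContinuousLinearMap.opNorm_comp_le _ _).trans ?_
  refine (mul_le_mul (norm_integralCLM_le μ) (CrossedProduct.norm_expect_le m)
    (norm_nonneg _) measureReal_nonneg).trans_eq (mul_one _)

/-- For monomials of degrees `k` and `l` there are two cases: if `m ∣ k + l` the orbit averages
agree, and otherwise the moment of degree `k + l` vanishes by invariance. Density then extends the
identity in one variable at a time. -/
lemma orbitFunctional_comm {m : ℕ+} {μ : Measure Circle} [IsFiniteMeasure μ]
    (h : IsRotationInvariant m μ) (a b : CrossedProduct) :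
    orbitFunctional m μ (a * b) = orbitFunctional m μ (b * a) := by
  let φ := orbitFunctional m μ
  let L := ContinuousLinearMap.mul ℂ CrossedProduct
  have key : ∀ f k, φ.comp (L (mon f k)) = φ.comp (L.flip (mon f k)) := by
    intro f k
    refine CrossedProduct.ext_mon fun g l => ?_
    simp only [L, φ, ContinuousLinearMap.comp_apply, ContinuousLinearMap.mul_apply',
      ContinuousLinearMap.flip_apply, CrossedProduct.mon_mul_mon, orbitFunctional_apply,
      integral_expect_mon]
    rw [add_comm l k]
    by_cases hkl : ((m : ℕ) : ℤ) ∣ k + l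
    · rw [orbitAverage_mul_translate hkl]
    · rw [(isRotationInvariant_iff m μ).1 h _ hkl, mul_zero, mul_zero]
  have h2 : φ.comp (L.flip b) = φ.comp (L b) :=
    CrossedProduct.ext_mon fun f k => DFunLike.congr_fun (key f k) b
  exact DFunLike.congr_fun h2 a

open scoped ComplexOrder in
lemma orbitFunctional_star_mul_self_nonneg (m : ℕ+) (μ : Measure Circle) [IsFiniteMeasure μ]
    (a : CrossedProduct) : 0 ≤ orbitFunctional m μ (star a * a) :=
  integral_nonneg fun z => CrossedProduct.expect_star_mul_self_nonneg m a z

open scoped ComplexOrder in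
/-- Every sequence of rotation invariant measures of total mass one defines a tracial state. -/
lemma exists_tracialState (hinv : ∀ m, IsRotationInvariant m (lam m))
    (h : ∑' m, lam m Set.univ = 1) :
    ∃ τ, IsTracialState τ ∧ IsPeriodicDecomposition τ lam := by
  have hfin := isFiniteMeasure_of_tsum h
  -- The norms are bounded by the masses, which sum to one, so the series converges absolutely in
  -- the dual space.
  have hs : Summable fun m => orbitFunctional m (lam m) :=
    (summable_real_univ h).of_norm_bounded fun m => norm_orbitFunctional_le m _
  obtain ⟨τ, hτ⟩ := hs
  have hsum : ∀ a, HasSum (fun m => orbitFunctional m (lam m) a) (τ a) := fun a =>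
    hτ.map (ContinuousLinearMap.apply ℂ ℂ a) (ContinuousLinearMap.apply ℂ ℂ a).continuous
  refine ⟨τ, ⟨?_, fun a => ?_, fun a b => ?_⟩, hinv, h, hsum⟩
  · refine (hsum 1).unique ?_
    have h1 : ∀ m, orbitFunctional m (lam m) 1 = (((lam m).real Set.univ : ℝ) : ℂ) := by
      intro m
      rw [← CrossedProduct.mon_one_zero, orbitFunctional_apply, integral_expect_mon,
        orbitAverage_one, one_mul, moment_zero]
    simp only [h1]
    have := (summable_real_univ h).hasSum
    rw [tsum_real_univ h] at this
    rw [← Complex.ofReal_one]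
    exact Complex.hasSum_ofReal.2 this
  · have := (hsum (star a * a)).nonneg fun m => orbitFunctional_star_mul_self_nonneg m (lam m) a
    exact ⟨(Complex.nonneg_iff.1 this).1, (Complex.nonneg_iff.1 this).2.symm⟩
  · refine (hsum (a * b)).unique ?_
    simp only [orbitFunctional_comm (hinv _) a b]
    exact hsum (b * a)

end Existence

/-! ### Uniqueness of the decomposition and the scaling condition -/

namespace IsPeriodicDecomposition

variable {τ : CrossedProduct →L[ℂ] ℂ} {lam : ℕ+ → Measure Circle}

lemma isFiniteMeasure (h : IsPeriodicDecomposition τ lam) (m : ℕ+) : IsFiniteMeasure (lam m) :=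
  isFiniteMeasure_of_tsum h.total m

lemma hasSum_mon (h : IsPeriodicDecomposition τ lam) (f : C(OmegaB, ℂ)) (k : ℤ) :
    HasSum (fun m => orbitAverage m f * moment (lam m) k) (τ (mon f k)) := by
  simpa only [integral_expect_mon] using h.hasSum (mon f k)

lemma eq_trace (h : IsPeriodicDecomposition τ lam) {τ' : CrossedProduct →L[ℂ] ℂ}
    (h' : IsPeriodicDecomposition τ' lam) : τ = τ' := by
  ext a
  exact (h.hasSum a).unique (h'.hasSum a)

lemma unique (h : IsPeriodicDecomposition τ lam) {lam' : ℕ+ → Measure Circle}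
    (h' : IsPeriodicDecomposition τ lam') : lam = lam' := by
  have hfin := h.isFiniteMeasure
  have hfin' := h'.isFiniteMeasure
  have key : ∀ k, (fun m => moment (lam m) k - moment (lam' m) k) = 0 := fun k => by
    refine eq_zero_of_tsum_orbitAverage
      ((summable_moment h.total k).sub (summable_moment h'.total k)) fun f => ?_
    have := ((h.hasSum_mon f k).sub (h'.hasSum_mon f k)).tsum_eq
    rw [sub_self] at this
    simpa only [mul_sub] using this
  funext m
  exact measure_ext_of_moment fun k => sub_eq_zero.1 (congrFun (key k) m)

/-- Only indices divisible by `n` contribute. Reindexing by `m ↦ nm` writes `τ ∘ α_n` in terms of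
the same averages `orbitAverage m f`, so its coefficients can be compared with those of `τ`. -/
lemma hasSum_alpha_mon (h : IsPeriodicDecomposition τ lam) (n : ℕ+) (f : C(OmegaB, ℂ)) (k : ℤ) :
    HasSum (fun m => orbitAverage m f * (((n : ℕ) : ℂ)⁻¹ * moment (lam (n * m)) ((n : ℕ) * k)))
      (τ (CrossedProduct.alpha n (mon f k))) := by
  have h1 := h.hasSum_mon (alphaFun n f) ((n : ℕ) * k)
  rw [CrossedProduct.alpha_mon]
  rw [← (pnat_mul_left_injective n).hasSum_iff] at h1
  · convert h1 using 2 with m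
    simp only [Function.comp_apply, orbitAverage_alphaFun_mul]
    ring
  · intro m hm
    rw [orbitAverage_alphaFun_of_not_dvd, zero_mul]
    rwa [range_pnat_mul_left] at hm

lemma natCast_inv_mul_eq_iff (n : ℕ+) (β : ℝ) (x y : ℂ) :
    ((n : ℕ) : ℂ)⁻¹ * x = ((((n : ℕ) : ℝ) ^ (-β) : ℝ) : ℂ) * y ↔
      x = ((((n : ℕ) : ℝ) ^ (1 - β) : ℝ) : ℂ) * y := by
  have hn : (0 : ℝ) < (n : ℕ) := by exact_mod_cast n.pos
  have hn' : ((n : ℕ) : ℂ) ≠ 0 := by exact_mod_cast n.ne_zero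
  rw [inv_mul_eq_iff_eq_mul₀ hn', sub_eq_add_neg, Real.rpow_add hn, Real.rpow_one]
  push_cast
  rw [mul_assoc]

/-- The scaling condition in terms of the moments of the measures in the decomposition. -/
lemma isScaling_iff (h : IsPeriodicDecomposition τ lam) (β : ℝ) :
    IsScaling β τ ↔ ∀ (n m : ℕ+) (k : ℤ), moment (lam (n * m)) ((n : ℕ) * k) =
      ((((n : ℕ) : ℝ) ^ (1 - β) : ℝ) : ℂ) * moment (lam m) k := by
  have hfin := h.isFiniteMeasure
  constructor
  · intro hs n m k
    have h1 : Summable fun m => ((n : ℕ) : ℂ)⁻¹ * moment (lam (n * m)) ((n : ℕ) * k) :=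
      ((summable_moment h.total _).comp_injective (pnat_mul_left_injective n)).mul_left _
    have h2 : Summable fun m => ((((n : ℕ) : ℝ) ^ (-β) : ℝ) : ℂ) * moment (lam m) k :=
      (summable_moment h.total k).mul_left _
    have h3 := eq_zero_of_tsum_orbitAverage (h1.sub h2) fun f => by
      have h4 := (h.hasSum_alpha_mon n f k).sub
        ((h.hasSum_mon f k).mul_left ((((n : ℕ) : ℝ) ^ (-β) : ℝ) : ℂ))
      rw [hs, sub_self] at h4
      rw [← h4.tsum_eq]
      exact tsum_congr fun m => by ring
    exact (natCast_inv_mul_eq_iff n β _ _).1 (sub_eq_zero.1 (congrFun h3 m))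
  · intro hm n
    have h1 : τ.comp (CrossedProduct.alpha n) = ((((n : ℕ) : ℝ) ^ (-β) : ℝ) : ℂ) • τ := by
      refine CrossedProduct.ext_mon fun f k => (h.hasSum_alpha_mon n f k).unique ?_
      simp only [(natCast_inv_mul_eq_iff n β _ _).2 (hm n _ k)]
      simpa only [mul_left_comm, smul_apply, smul_eq_mul] using
        (h.hasSum_mon f k).mul_left ((((n : ℕ) : ℝ) ^ (-β) : ℝ) : ℂ)
    exact DFunLike.congr_fun h1

end IsPeriodicDecomposition

/-! ### The zeta function -/

lemma re_riemannZeta_eq_tsum {β : ℝ} (hβ : 2 < β) :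
    (riemannZeta ((β - 1 : ℝ) : ℂ)).re = ∑' n : ℕ, (n : ℝ) ^ (1 - β) := by
  rw [zeta_eq_tsum_one_div_nat_cpow (by rw [Complex.ofReal_re]; linarith)]
  have h : ∀ n : ℕ, 1 / (n : ℂ) ^ ((β - 1 : ℝ) : ℂ) = (((n : ℝ) ^ (1 - β) : ℝ) : ℂ) := by
    intro n
    rw [← neg_sub β 1, Real.rpow_neg (Nat.cast_nonneg n), one_div, Complex.ofReal_inv,
      Complex.ofReal_cpow (Nat.cast_nonneg n), Complex.ofReal_natCast]
  rw [tsum_congr h, ← Complex.ofReal_tsum, Complex.ofReal_re]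

lemma summable_pnat_rpow_iff {s : ℝ} : Summable (fun n : ℕ+ => ((n : ℕ) : ℝ) ^ s) ↔ s < -1 := by
  rw [← Real.summable_nat_rpow]
  exact summable_pnat_iff_summable_nat (f := fun n : ℕ => (n : ℝ) ^ s)

lemma tsum_ofReal_rpow {β : ℝ} (hβ : 2 < β) :
    ∑' n : ℕ+, ENNReal.ofReal (((n : ℕ) : ℝ) ^ (1 - β)) =
      ENNReal.ofReal (riemannZeta ((β - 1 : ℝ) : ℂ)).re := by
  have hs : Summable fun n : ℕ+ => ((n : ℕ) : ℝ) ^ (1 - β) :=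
    summable_pnat_rpow_iff.2 (by linarith)
  rw [← ENNReal.ofReal_tsum_of_nonneg (fun n => by positivity) hs, re_riemannZeta_eq_tsum hβ]
  congr 1
  refine PNat.coe_injective.tsum_eq (f := fun n : ℕ => (n : ℝ) ^ (1 - β)) fun n hn => ?_
  refine ⟨⟨n, Nat.pos_of_ne_zero ?_⟩, rfl⟩
  rintro rfl
  -- The index `0` contributes nothing, since `0^s = 0` for real `s ≠ 0`.
  exact hn (by simpa using Real.zero_rpow (by linarith : 1 - β ≠ 0))

lemma ofReal_re_riemannZeta_ne_zero {β : ℝ} (hβ : 2 < β) :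
    ENNReal.ofReal (riemannZeta ((β - 1 : ℝ) : ℂ)).re ≠ 0 := by
  rw [← tsum_ofReal_rpow hβ]
  intro h
  simpa using ENNReal.tsum_eq_zero.1 h 1

/-! ### The classification -/

namespace IsPeriodicDecomposition

variable {β : ℝ} {τ : CrossedProduct →L[ℂ] ℂ} {lam : ℕ+ → Measure Circle}

lemma moment_mul (h : IsPeriodicDecomposition τ lam) (hs : IsScaling β τ) (n : ℕ+) (k : ℤ) :
    moment (lam n) ((n : ℕ) * k) = ((((n : ℕ) : ℝ) ^ (1 - β) : ℝ) : ℂ) * moment (lam 1) k := by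
  simpa using (h.isScaling_iff β).1 hs n 1 k

/-- The mass is the moment of degree zero. -/
lemma real_univ_eq (h : IsPeriodicDecomposition τ lam) (hs : IsScaling β τ) (n : ℕ+) :
    (lam n).real Set.univ = ((n : ℕ) : ℝ) ^ (1 - β) * (lam 1).real Set.univ := by
  have := h.moment_mul hs n 0
  rw [mul_zero, moment_zero, moment_zero] at this
  exact_mod_cast this

lemma real_univ_one_ne_zero (h : IsPeriodicDecomposition τ lam) (hs : IsScaling β τ) :
    (lam 1).real Set.univ ≠ 0 := by
  intro h0
  have h1 := tsum_real_univ h.total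
  rw [tsum_congr (h.real_univ_eq hs), h0] at h1
  simp at h1

/-- The masses `n^(1-β) λ_1(𝕋)` are summable with `λ_1(𝕋) ≠ 0`, so `1 - β < -1`. -/
lemma two_lt (h : IsPeriodicDecomposition τ lam) (hs : IsScaling β τ) : 2 < β := by
  have h1 := summable_real_univ h.total
  rw [funext (h.real_univ_eq hs)] at h1
  have h2 := summable_pnat_rpow_iff.1
    ((summable_mul_right_iff (h.real_univ_one_ne_zero hs)).1 h1)
  linarith

lemma zeta_mul_univ (h : IsPeriodicDecomposition τ lam) (hs : IsScaling β τ) :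
    ENNReal.ofReal (riemannZeta ((β - 1 : ℝ) : ℂ)).re * lam 1 Set.univ = 1 := by
  have hfin := h.isFiniteMeasure
  rw [← tsum_ofReal_rpow (h.two_lt hs), ← ENNReal.tsum_mul_right, ← h.total]
  refine tsum_congr fun n => ?_
  rw [← ofReal_measureReal (μ := lam n), h.real_univ_eq hs, ENNReal.ofReal_mul (by positivity),
    ofReal_measureReal]

lemma isProbabilityMeasure (h : IsPeriodicDecomposition τ lam) (hs : IsScaling β τ) :
    IsProbabilityMeasure (ENNReal.ofReal (riemannZeta ((β - 1 : ℝ) : ℂ)).re • lam 1) :=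
  ⟨h.zeta_mul_univ hs⟩

/-- A scaling trace is determined by `λ₁`. -/
lemma eq_of_one_eq (h : IsPeriodicDecomposition τ lam) (hs : IsScaling β τ)
    {τ' : CrossedProduct →L[ℂ] ℂ} {lam' : ℕ+ → Measure Circle}
    (h' : IsPeriodicDecomposition τ' lam') (hs' : IsScaling β τ') (h1 : lam 1 = lam' 1) :
    τ = τ' := by
  have hfin := h.isFiniteMeasure
  have hfin' := h'.isFiniteMeasure
  have hl : lam = lam' := by
    funext n
    refine measure_ext_of_moment fun k => ?_
    -- On `nℤ` the moments come from `λ_1` by scaling; off `nℤ` they vanish by invariance.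
    by_cases hk : ((n : ℕ) : ℤ) ∣ k
    · obtain ⟨k, rfl⟩ := hk
      rw [h.moment_mul hs, h'.moment_mul hs', h1]
    · rw [(isRotationInvariant_iff n _).1 (h.invariant n) k hk,
        (isRotationInvariant_iff n _).1 (h'.invariant n) k hk]
  subst hl
  exact h.eq_trace h'

lemma convexComb (h : IsPeriodicDecomposition τ lam) {τ' : CrossedProduct →L[ℂ] ℂ}
    {lam' : ℕ+ → Measure Circle} (h' : IsPeriodicDecomposition τ' lam') {t : ℝ} (h0 : 0 ≤ t)
    (h1 : t ≤ 1) :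
    IsPeriodicDecomposition ((t : ℂ) • τ + ((1 - t : ℝ) : ℂ) • τ')
      (fun m => ENNReal.ofReal t • lam m + ENNReal.ofReal (1 - t) • lam' m) := by
  have hfin := h.isFiniteMeasure
  have hfin' := h'.isFiniteMeasure
  have hf : ∀ (s : ℝ) (μ : Measure Circle) [IsFiniteMeasure μ],
      IsFiniteMeasure (ENNReal.ofReal s • μ) :=
    fun s μ _ => Measure.smul_finite μ ENNReal.ofReal_ne_top
  have ht : 0 ≤ 1 - t := sub_nonneg.2 h1
  refine ⟨fun m => ?_, ?_, fun a => ?_⟩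
  · have := hf t (lam m)
    have := hf (1 - t) (lam' m)
    refine (isRotationInvariant_iff m _).2 fun k hk => ?_
    rw [moment_add, moment_smul, moment_smul,
      (isRotationInvariant_iff m _).1 (h.invariant m) k hk,
      (isRotationInvariant_iff m _).1 (h'.invariant m) k hk]
    simp
  · simp only [Measure.add_apply, Measure.smul_apply, smul_eq_mul]
    rw [ENNReal.tsum_add, ENNReal.tsum_mul_left, ENNReal.tsum_mul_left, h.total, h'.total, mul_one,
      mul_one, ← ENNReal.ofReal_add h0 ht]
    simp
  · refine (((h.hasSum a).mul_left (t : ℂ)).add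
      ((h'.hasSum a).mul_left ((1 - t : ℝ) : ℂ))).congr_fun fun m => ?_
    have := hf t (lam m)
    have := hf (1 - t) (lam' m)
    rw [integral_add_measure (integrable_circle _ _) (integrable_circle _ _),
      integral_smul_measure, integral_smul_measure, ENNReal.toReal_ofReal h0,
      ENNReal.toReal_ofReal ht]
    rfl

end IsPeriodicDecomposition

lemma IsTracialState.convexComb {τ τ' : CrossedProduct →L[ℂ] ℂ} (h : IsTracialState τ)
    (h' : IsTracialState τ') {t : ℝ} (h0 : 0 ≤ t) (h1 : t ≤ 1) :
    IsTracialState ((t : ℂ) • τ + ((1 - t : ℝ) : ℂ) • τ') where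
  map_one := by simp [h.map_one, h'.map_one]
  nonneg a := by
    obtain ⟨hr, hi⟩ := h.nonneg a
    obtain ⟨hr', hi'⟩ := h'.nonneg a
    have ht : 0 ≤ 1 - t := sub_nonneg.2 h1
    simp only [add_apply, smul_apply, smul_eq_mul,
      Complex.add_re, Complex.add_im, Complex.re_ofReal_mul, Complex.im_ofReal_mul, hi, hi']
    exact ⟨by positivity, by simp⟩
  tracial a b := by simp [h.tracial a b, h'.tracial a b]

lemma IsScaling.linearComb {β : ℝ} {τ τ' : CrossedProduct →L[ℂ] ℂ} (h : IsScaling β τ)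
    (h' : IsScaling β τ') (s t : ℂ) : IsScaling β (s • τ + t • τ') := by
  intro n a
  simp only [add_apply, smul_apply, smul_eq_mul, h n a,
    h' n a]
  ring

lemma rootLift_one (μ : Measure Circle) [IsFiniteMeasure μ] : rootLift 1 μ = μ :=
  measure_ext_of_moment fun k => by simpa using moment_rootLift_mul 1 μ k

/-- Every probability measure on the circle comes from a scaling trace. -/
lemma exists_scalingTrace {β : ℝ} (hβ : 2 < β) (μ : Measure Circle) [IsProbabilityMeasure μ] :
    ∃ τ ∈ scalingTraces β, ∃ lam, IsPeriodicDecomposition τ lam ∧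
      ENNReal.ofReal (riemannZeta ((β - 1 : ℝ) : ℂ)).re • lam 1 = μ := by
  set Z := ENNReal.ofReal (riemannZeta ((β - 1 : ℝ) : ℂ)).re with hZ
  have hZ0 : Z ≠ 0 := ofReal_re_riemannZeta_ne_zero hβ
  have hZt : Z ≠ ⊤ := ENNReal.ofReal_ne_top
  -- These are the masses forced by scaling; dividing by `Z = ζ(β-1)` makes them sum to one.
  let w : ℕ+ → ENNReal := fun n => ENNReal.ofReal (((n : ℕ) : ℝ) ^ (1 - β)) * Z⁻¹
  have hw : ∀ n, w n ≠ ⊤ := fun n =>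
    ENNReal.mul_ne_top ENNReal.ofReal_ne_top (ENNReal.inv_ne_top.2 hZ0)
  let lam : ℕ+ → Measure Circle := fun n => w n • rootLift n μ
  have hfin : ∀ n, IsFiniteMeasure (lam n) := fun n => Measure.smul_finite _ (hw n)
  have hwr : ∀ n, (w n).toReal = ((n : ℕ) : ℝ) ^ (1 - β) * Z.toReal⁻¹ := fun n => by
    rw [ENNReal.toReal_mul, ENNReal.toReal_inv, ENNReal.toReal_ofReal (by positivity)]
  have hinv : ∀ n, IsRotationInvariant n (lam n) := fun n =>
    (isRotationInvariant_iff n _).2 fun k hk => by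
      rw [moment_smul, moment_rootLift_of_not_dvd n μ hk, mul_zero]
  have htot : ∑' n, lam n Set.univ = 1 := by
    simp only [lam, w, Measure.smul_apply, rootLift_univ, measure_univ, smul_eq_mul, mul_one]
    rw [ENNReal.tsum_mul_right, tsum_ofReal_rpow hβ, ENNReal.mul_inv_cancel hZ0 hZt]
  obtain ⟨τ, hτ, hdec⟩ := exists_tracialState hinv htot
  refine ⟨τ, ⟨hτ, (hdec.isScaling_iff β).2 fun n m k => ?_, lam, hdec⟩, lam, hdec, ?_⟩
  · rw [moment_smul, moment_smul, hwr, hwr, PNat.mul_coe, Nat.cast_mul,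
      Real.mul_rpow (by positivity) (by positivity)]
    -- Both sides vanish unless `m ∣ k`, and for `k = mj` both equal the `j`-th moment of `μ`. The
    -- weights account for the remaining factor `n^(1-β)`.
    have : moment (rootLift (n * m) μ) ((n : ℕ) * k) = moment (rootLift m μ) k := by
      by_cases hk : ((m : ℕ) : ℤ) ∣ k
      · obtain ⟨k, rfl⟩ := hk
        rw [moment_rootLift_mul, ← mul_assoc]
        simpa using moment_rootLift_mul (n * m) μ k
      · rw [moment_rootLift_of_not_dvd m μ hk, moment_rootLift_of_not_dvd]
        rw [PNat.mul_coe, Nat.cast_mul]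
        exact fun h => hk (Int.dvd_of_mul_dvd_mul_left (by exact_mod_cast n.ne_zero) h)
    rw [this]
    push_cast
    ring
  · simp only [lam, w, rootLift_one, smul_smul]
    simp [ENNReal.mul_inv_cancel hZ0 hZt]

end AddBoundary

/-! ### The affine bijection with probability measures. -/

open AddBoundary MeasureTheory

theorem proposition2p3 (β : ℝ) :
    (2 < β →
      (∀ τ ∈ AddBoundary.scalingTraces β,
        ∃! lam : ℕ+ → MeasureTheory.Measure Circle,
          AddBoundary.IsPeriodicDecomposition τ lam) ∧
      ∃ Φ : AddBoundary.scalingTraces β ≃ MeasureTheory.ProbabilityMeasure Circle,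
        (∀ (τ : AddBoundary.scalingTraces β) (lam : ℕ+ → MeasureTheory.Measure Circle),
          AddBoundary.IsPeriodicDecomposition (τ : AddBoundary.CrossedProduct →L[ℂ] ℂ) lam →
            (Φ τ : MeasureTheory.Measure Circle) =
              ENNReal.ofReal (riemannZeta ((β - 1 : ℝ) : ℂ)).re • lam 1) ∧
        (∀ (τ₀ τ₁ : AddBoundary.scalingTraces β) (t : ℝ), 0 ≤ t → t ≤ 1 →
          ∃ h : (t : ℂ) • (τ₀ : AddBoundary.CrossedProduct →L[ℂ] ℂ) +
              ((1 - t : ℝ) : ℂ) • (τ₁ : AddBoundary.CrossedProduct →L[ℂ] ℂ) ∈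
                AddBoundary.scalingTraces β,
            (Φ ⟨_, h⟩ : MeasureTheory.Measure Circle) =
              ENNReal.ofReal t • (Φ τ₀ : MeasureTheory.Measure Circle) +
                ENNReal.ofReal (1 - t) • (Φ τ₁ : MeasureTheory.Measure Circle))) ∧
    (β ≤ 2 → AddBoundary.scalingTraces β = ∅) := by
  refine ⟨fun hβ => ⟨?_, ?_⟩, fun hβ => ?_⟩
  · rintro τ ⟨-, -, lam, h⟩
    exact ⟨lam, h, fun lam' h' => h'.unique h⟩
  · set Z := ENNReal.ofReal (riemannZeta ((β - 1 : ℝ) : ℂ)).re with hZ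
    have hZ0 : Z ≠ 0 := ofReal_re_riemannZeta_ne_zero hβ
    have hZt : Z ≠ ⊤ := ENNReal.ofReal_ne_top
    choose L hL using fun τ : scalingTraces β => τ.2.2.2
    let F : scalingTraces β → ProbabilityMeasure Circle :=
      fun τ => ⟨Z • L τ 1, (hL τ).isProbabilityMeasure τ.2.2.1⟩
    -- By uniqueness the chosen decomposition may be replaced by any other, so surjectivity and
    -- affinity can be checked on explicit decompositions.
    have hF : ∀ (τ : scalingTraces β) (lam : ℕ+ → Measure Circle),
        IsPeriodicDecomposition (τ : CrossedProduct →L[ℂ] ℂ) lam →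
          (F τ : Measure Circle) = Z • lam 1 := fun τ lam h => by
      rw [(hL τ).unique h |>.symm]; rfl
    have hinj : Function.Injective F := by
      intro τ τ' h
      have h1 : Z • L τ 1 = Z • L τ' 1 := congrArg Subtype.val h
      have h2 := congrArg (fun μ : Measure Circle => Z⁻¹ • μ) h1
      simp only [smul_smul, ENNReal.inv_mul_cancel hZ0 hZt, one_smul] at h2
      exact Subtype.ext ((hL τ).eq_of_one_eq τ.2.2.1 (hL τ') τ'.2.2.1 h2)
    have hsurj : Function.Surjective F := by
      intro μ
      obtain ⟨τ, hτ, lam, hlam, h⟩ := exists_scalingTrace hβ (μ : Measure Circle)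
      exact ⟨⟨τ, hτ⟩, Subtype.ext ((hF ⟨τ, hτ⟩ lam hlam).trans h)⟩
    refine ⟨Equiv.ofBijective F ⟨hinj, hsurj⟩, hF, fun τ₀ τ₁ t h0 h1 => ?_⟩
    have hdec := (hL τ₀).convexComb (hL τ₁) h0 h1
    refine ⟨⟨τ₀.2.1.convexComb τ₁.2.1 h0 h1, τ₀.2.2.1.linearComb τ₁.2.2.1 _ _, _, hdec⟩, ?_⟩
    refine (hF _ _ hdec).trans ?_
    change _ = ENNReal.ofReal t • (F τ₀ : Measure Circle) +
      ENNReal.ofReal (1 - t) • (F τ₁ : Measure Circle)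
    rw [hF τ₀ _ (hL τ₀), hF τ₁ _ (hL τ₁), smul_add, smul_comm Z, smul_comm Z]
  · refine Set.eq_empty_of_forall_notMem ?_
    rintro τ ⟨-, hs, lam, h⟩
    exact (h.two_lt hs).not_ge hβ

end
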